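/- Let $M$ be a smooth connected affine algebraic variety over $\mathbf C$ and let $\nabla$ be a linear connection on its tangent bundle $TM$, rational or regular (a regular connection being a rational one without poles). Its reciprocal connection is $$\nabla^{\rm rec}_X Y=\nabla_Y X+[X,Y],$$ and its torsion is $\operatorname{Tor}_\nabla(X,Y)=\nabla_XY-\nabla_YX-[X,Y]$. A connection is flat if its curvature $\nabla_X\nabla_Y-\nabla_Y\nabla_X-\nabla_{[X,Y]}$ vanishes. A vector field $Y$ is $\nabla$-horizontal if $\nabla_XY=0$ for every $X$. The connection $\nabla$ is called a Lie connection if it is flat and, near every complex point of $M$ at which $\nabla$ is regular, the Lie bracket of any two local complex analytic $\nabla$-horizontal vector fields is again $\nabla$-horizontal. Then the following statements are equivalent: 1. $\nabla$ is a Lie connection; 2. $\nabla^{\rm rec}$ is a Lie connection; 3. $\nabla$ is flat and its torsion is parallel, $\nabla\operatorname{Tor}_\nabla=0$, that is, $\nabla_X(\operatorname{Tor}_\nabla(Y,Z))-\operatorname{Tor}_\nabla(\nabla_XY,Z)-\operatorname{Tor}_\nabla(Y,\nabla_XZ)=0$ for all rational vector fields $X,Y,Z$ on $M$; 4. $\nabla$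 and $\nabla^{\rm rec}$ are both flat. -/

import Mathlib

open Filter Topology

noncomputable section

namespace LieConn

section Connections

/-- A linear connection on the module of vector fields `Der_k(R)`, given by its covariant
derivative `cov X Y = ∇_X Y`: it is `R`-linear in `X`, `k`-linear in `Y` and satisfies the Leibniz
rule in `Y`. For `R` the field of rational functions of a variety `M` this is a rational linear
connection on `TM`; for `R` the ring of germs of analytic functions at a point it is a germ of
analytic connection on `TM`. -/
structure Connection (k R : Type*) [CommRing k] [CommRing R] [Algebra k R] where
  cov : Derivation k R R →ₗ[R] Derivation k R R →ₗ[k] Derivation k R R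
  leibniz : ∀ (X Y : Derivation k R R) (f : R), cov X (f • Y) = X f • Y + f • cov X Y

variable {k R : Type*} [CommRing k] [CommRing R] [Algebra k R]

theorem smul_lie_der (X Y : Derivation k R R) (f : R) :
    ⁅f • X, Y⁆ = f • ⁅X, Y⁆ - Y f • X := by
  ext a
  simp only [Derivation.commutator_apply, Derivation.smul_apply, Derivation.sub_apply,
    smul_eq_mul, Derivation.leibniz]
  ring

theorem lie_smul_der (X Y : Derivation k R R) (f : R) :
    ⁅X, f • Y⁆ = f • ⁅X, Y⁆ + X f • Y := by
  ext a
  simp only [Derivation.commutator_apply, Derivation.smul_apply, Derivation.add_apply,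
    smul_eq_mul, Derivation.leibniz]
  ring

namespace Connection

/-- The reciprocal connection `∇^rec_X Y = ∇_Y X + [X, Y]`. -/
def reciprocal (D : Connection k R) : Connection k R where
  cov :=
    { toFun := fun X =>
        { toFun := fun Y => D.cov Y X + ⁅X, Y⁆
          map_add' := fun Y Z => by
            simp only [map_add, LinearMap.add_apply, lie_add]; abel
          map_smul' := fun c Y => by
            have h : D.cov (c • Y) X = c • D.cov Y X := by
              rw [← algebraMap_smul R c Y, map_smul, LinearMap.smul_apply, algebraMap_smul]
            simp only [h, lie_smul, smul_add, RingHom.id_apply] }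
      map_add' := fun X Y => by
        ext1 Z
        simp only [LinearMap.coe_mk, AddHom.coe_mk, LinearMap.add_apply, map_add, add_lie]; abel
      map_smul' := fun f X => by
        ext1 Y
        simp only [LinearMap.coe_mk, AddHom.coe_mk, LinearMap.smul_apply, RingHom.id_apply,
          D.leibniz, smul_lie_der, smul_add]
        abel }
  leibniz := fun X Y f => by
    simp only [LinearMap.coe_mk, AddHom.coe_mk, map_smul, LinearMap.smul_apply, lie_smul_der,
      smul_add]
    abel

/-- The curvature `R(X, Y) Z = ∇_X ∇_Y Z - ∇_Y ∇_X Z - ∇_[X,Y] Z`. -/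
def curvature (D : Connection k R) (X Y Z : Derivation k R R) : Derivation k R R :=
  D.cov X (D.cov Y Z) - D.cov Y (D.cov X Z) - D.cov ⁅X, Y⁆ Z

def IsFlat (D : Connection k R) : Prop :=
  ∀ X Y Z, D.curvature X Y Z = 0

/-- The torsion `Tor(X, Y) = ∇_X Y - ∇_Y X - [X, Y]`. -/
def torsion (D : Connection k R) (X Y : Derivation k R R) : Derivation k R R :=
  D.cov X Y - D.cov Y X - ⁅X, Y⁆

/-- The covariant derivative of the torsion tensor,
`(∇_X Tor)(Y, Z) = ∇_X (Tor(Y, Z)) - Tor(∇_X Y, Z) - Tor(Y, ∇_X Z)`. -/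
def covTorsion (D : Connection k R) (X Y Z : Derivation k R R) : Derivation k R R :=
  D.cov X (D.torsion Y Z) - D.torsion (D.cov X Y) Z - D.torsion Y (D.cov X Z)

/-- `∇ Tor = 0`. -/
def HasParallelTorsion (D : Connection k R) : Prop :=
  ∀ X Y Z, D.covTorsion X Y Z = 0

/-- `Y` is horizontal: `∇_X Y = 0` for all `X`. -/
def IsHorizontal (D : Connection k R) (Y : Derivation k R R) : Prop :=
  ∀ X, D.cov X Y = 0

end Connection

end Connections

section Analytic

variable (A : Type*) [CommRing A] [Algebra ℂ A]

/-- The complex points of the affine variety with coordinate ring `A`. -/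
structure Point where
  eval : A →ₐ[ℂ] ℂ

/-- The classical (Euclidean) topology: the coarsest one for which all regular functions are
continuous. -/
instance : TopologicalSpace (Point A) :=
  TopologicalSpace.induced (fun (x : Point A) (a : A) => x.eval a) inferInstance

variable {A}

/-- Germs of complex-valued functions form a complex algebra, with Mathlib's pointwise operations. -/
instance germAlgebra {P : Type*} (l : Filter P) : Algebra ℂ (Germ l ℂ) :=
  Algebra.ofModule
    (fun c f g => by
      induction f using Germ.inductionOn
      induction g using Germ.inductionOn
      exact congrArg Germ.ofFun (smul_mul_assoc c _ _))
    (fun c f g => by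
      induction f using Germ.inductionOn
      induction g using Germ.inductionOn
      exact congrArg Germ.ofFun (mul_smul_comm c _ _))

/-- The ring of germs at `x` of analytic functions on the variety: the germs of the
functions `y ↦ F (a₁(y), …, aₙ(y))` with `a₁, …, aₙ` regular functions and `F` a function on `ℂⁿ`
that is analytic at `(a₁(x), …, aₙ(x))`. -/
def AnalyticGerm (x : Point A) : Subalgebra ℂ (Germ (𝓝 x) ℂ) where
  carrier := {g | ∃ (n : ℕ) (a : Fin n → A) (F : (Fin n → ℂ) → ℂ),
    AnalyticAt ℂ F (fun i => x.eval (a i)) ∧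
      g = ((fun y : Point A => F (fun i => y.eval (a i)) : Point A → ℂ) : Germ (𝓝 x) ℂ)}
  add_mem' := by
    rintro _ _ ⟨m, a, F, hF, rfl⟩ ⟨n, b, G, hG, rfl⟩
    refine ⟨m + n, Fin.append a b,
      fun z => F (fun i => z (Fin.castAdd n i)) + G (fun i => z (Fin.natAdd m i)), ?_, ?_⟩
    · refine AnalyticAt.add ?_ ?_
      · refine AnalyticAt.fun_comp (g := F) (f := fun (z : Fin (m + n) → ℂ) i => z (Fin.castAdd n i))
          (by simpa using hF) ?_
        exact AnalyticAt.pi fun i =>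
          (ContinuousLinearMap.proj (R := ℂ) (φ := fun _ : Fin (m + n) => ℂ)
            (Fin.castAdd n i)).analyticAt _
      · refine AnalyticAt.fun_comp (g := G) (f := fun (z : Fin (m + n) → ℂ) i => z (Fin.natAdd m i))
          (by simpa using hG) ?_
        exact AnalyticAt.pi fun i =>
          (ContinuousLinearMap.proj (R := ℂ) (φ := fun _ : Fin (m + n) => ℂ)
            (Fin.natAdd m i)).analyticAt _
    · simp only [Fin.append_left, Fin.append_right]
      rfl
  mul_mem' := by
    rintro _ _ ⟨m, a, F, hF, rfl⟩ ⟨n, b, G, hG, rfl⟩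
    refine ⟨m + n, Fin.append a b,
      fun z => F (fun i => z (Fin.castAdd n i)) * G (fun i => z (Fin.natAdd m i)), ?_, ?_⟩
    · refine AnalyticAt.mul ?_ ?_
      · refine AnalyticAt.fun_comp (g := F) (f := fun (z : Fin (m + n) → ℂ) i => z (Fin.castAdd n i))
          (by simpa using hF) ?_
        exact AnalyticAt.pi fun i =>
          (ContinuousLinearMap.proj (R := ℂ) (φ := fun _ : Fin (m + n) => ℂ)
            (Fin.castAdd n i)).analyticAt _
      · refine AnalyticAt.fun_comp (g := G) (f := fun (z : Fin (m + n) → ℂ) i => z (Fin.natAdd m i))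
          (by simpa using hG) ?_
        exact AnalyticAt.pi fun i =>
          (ContinuousLinearMap.proj (R := ℂ) (φ := fun _ : Fin (m + n) => ℂ)
            (Fin.natAdd m i)).analyticAt _
    · simp only [Fin.append_left, Fin.append_right]
      rfl
  algebraMap_mem' := fun c => ⟨0, Fin.elim0, fun _ => c, analyticAt_const, by
    rw [Algebra.algebraMap_eq_smul_one]
    exact congrArg Germ.ofFun (funext fun _ => mul_one c)⟩

/-- The analytic germ at `x` of a regular function. -/
def regularGerm (x : Point A) (a : A) : AnalyticGerm x :=
  ⟨((fun y : Point A => y.eval a : Point A → ℂ) : Germ (𝓝 x) ℂ),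
    1, fun _ => a, fun z => z 0,
    (ContinuousLinearMap.proj (R := ℂ) (φ := fun _ : Fin 1 => ℂ) 0).analyticAt _, rfl⟩

variable {K : Type*} [Field K] [Algebra A K] [Algebra ℂ K]

/-- `g` is the analytic germ at `x` of the rational function `f`: for some regular functions `b` and
`c ≠ 0`, `f = b / c` as rational functions and `g c = b` as germs at `x`. -/
def IsFunctionGerm (x : Point A) (f : K) (g : AnalyticGerm x) : Prop :=
  ∃ b c : A, algebraMap A K c ≠ 0 ∧ f * algebraMap A K c = algebraMap A K b ∧
    g * regularGerm x c = regularGerm x b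

/-- `V` is the analytic germ at `x` of the rational vector field `X`
(in particular `X` is regular at `x`). -/
def IsFieldGerm (x : Point A) (X : Derivation ℂ K K)
    (V : Derivation ℂ (AnalyticGerm x) (AnalyticGerm x)) : Prop :=
  ∀ a : A, IsFunctionGerm x (X (algebraMap A K a)) (V (regularGerm x a))

/-- `E` is the analytic germ at `x` of the rational connection `D`: a germ of analytic connection
on the tangent bundle that agrees with `D` on the rational vector fields regular at `x`.
On a smooth variety it exists exactly when `D` is regular at `x`, and then it is unique, since
the vector fields regular at `x` span those with analytic coefficients. -/
def IsConnectionGerm (x : Point A) (D : Connection ℂ K) (E : Connection ℂ (AnalyticGerm x)) : Prop :=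
  ∀ (X Y : Derivation ℂ K K) (V W : Derivation ℂ (AnalyticGerm x) (AnalyticGerm x)),
    IsFieldGerm x X V → IsFieldGerm x Y W → IsFieldGerm x (D.cov X Y) (E.cov V W)

variable (A) in
/-- A rational connection `D` on the tangent bundle of the affine variety with coordinate ring
`A` and function field `K` is a Lie connection if it is flat and, around every point where `D` is
regular, the Lie bracket of two local analytic horizontal vector fields is horizontal.
A regular connection is the particular case where all points are regular for `D`. -/
def IsLieConnection (D : Connection ℂ K) : Prop :=
  D.IsFlat ∧ ∀ (x : Point A) (E : Connection ℂ (AnalyticGerm x)), IsConnectionGerm x D E →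
    ∀ Y Z : Derivation ℂ (AnalyticGerm x) (AnalyticGerm x),
      E.IsHorizontal Y → E.IsHorizontal Z → E.IsHorizontal ⁅Y, Z⁆

end Analytic

end LieConn

end

/-! The algebraic core is one identity, valid for every connection on a module of derivations and
resting only on the Jacobi identity: R^rec(X,Y)Z = (∇_Z Tor)(X,Y) - R(Y,Z)X + R(X,Z)Y
(`Connection.reciprocal_curvature`). If ∇ is flat, parallel torsion therefore means flatness of
∇^rec. Since reciprocity is an involution, flatness of both connections is a symmetric condition, so
everything reduces to one claim, applied to ∇ and to ∇^rec: a flat connection is Lie if and only if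
its torsion is parallel (`isLieConnection_iff`).

For horizontal Y, Z one has Tor(Y,Z) = -[Y,Z], hence (∇_X Tor)(Y,Z) = -∇_X[Y,Z]. Parallel torsion
thus makes brackets of horizontal fields horizontal. Conversely, a flat analytic connection has a
local horizontal frame, and ∇Tor is a tensor, so it vanishes once it vanishes on that frame.

The rest transfers this between rational fields and analytic germs. The Frobenius theorem
(`exists_analyticAt_parallel`) is obtained by integrating along rays from the origin: the radial
equation is solved by inverting a Volterra operator depending analytically on the endpoint, and
flatness forces the remaining derivatives to be right. Around each point of the smooth variety, a
submersive presentation and the inverse function theorem identify the analytic germs with those on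
an affine space (`exists_localRing_equiv`). Rational functions inject into germs because they are
algebraic over coordinates that stay algebraically independent as germs (`localizedGerm_injective`),
so vanishing of curvature and of ∇Tor passes between the two settings. Finally, clearing the
denominators of the Christoffel symbols yields at least one point where ∇ is regular. -/

noncomputable section

namespace LieConn

/-! ### Algebra of connections: reciprocal, torsion and curvature. -/

section Algebra

variable {k R : Type*} [CommRing k] [CommRing R] [Algebra k R]

namespace Connection

theorem reciprocal_cov (D : Connection k R) (X Y : Derivation k R R) :
    D.reciprocal.cov X Y = D.cov Y X + ⁅X, Y⁆ := rfl

theorem cov_ext {D E : Connection k R} (h : ∀ X Y, D.cov X Y = E.cov X Y) : D = E := by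
  cases D
  cases E
  congr 1
  ext1 X
  ext1 Y
  exact h X Y

theorem reciprocal_reciprocal (D : Connection k R) : D.reciprocal.reciprocal = D := by
  refine cov_ext fun X Y => ?_
  rw [reciprocal_cov, reciprocal_cov, ← lie_skew X Y]
  abel

/-- First Bianchi-type identity relating the curvatures of a connection and of its reciprocal with
the covariant derivative of the torsion. -/
theorem reciprocal_curvature (D : Connection k R) (X Y Z : Derivation k R R) :
    D.reciprocal.curvature X Y Z =
      D.covTorsion Z X Y - D.curvature Y Z X + D.curvature X Z Y := by
  have hJ : ⁅X, ⁅Y, Z⁆⁆ = ⁅⁅X, Y⁆, Z⁆ + ⁅Y, ⁅X, Z⁆⁆ := leibniz_lie X Y Z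
  have hs : ⁅D.cov Z X, Y⁆ = -⁅Y, D.cov Z X⁆ := (lie_skew _ _).symm
  simp only [curvature, covTorsion, torsion, reciprocal_cov, map_add, map_sub, hJ, hs]
  abel

/-- Flatness removes both curvature terms of `reciprocal_curvature`, leaving R^rec(X,Y)Z = (∇_Z
Tor)(X,Y); the two quantifications differ only by a cyclic shift of the arguments. -/
theorem IsFlat.hasParallelTorsion_iff {D : Connection k R} (hD : D.IsFlat) :
    D.HasParallelTorsion ↔ D.reciprocal.IsFlat := by
  constructor
  · intro h X Y Z
    rw [reciprocal_curvature, h, hD, hD]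
    simp
  · intro h X Y Z
    have := reciprocal_curvature D Y Z X
    rw [h, hD, hD] at this
    simpa using this.symm

theorem torsion_add_left (D : Connection k R) (X X' Y : Derivation k R R) :
    D.torsion (X + X') Y = D.torsion X Y + D.torsion X' Y := by
  simp only [torsion, map_add, LinearMap.add_apply, add_lie]
  abel

theorem torsion_add_right (D : Connection k R) (X Y Y' : Derivation k R R) :
    D.torsion X (Y + Y') = D.torsion X Y + D.torsion X Y' := by
  simp only [torsion, map_add, LinearMap.add_apply, lie_add]
  abel

theorem torsion_smul_left (D : Connection k R) (f : R) (X Y : Derivation k R R) :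
    D.torsion (f • X) Y = f • D.torsion X Y := by
  simp only [torsion, map_smul, LinearMap.smul_apply, D.leibniz, smul_lie_der, smul_sub]
  abel

theorem torsion_smul_right (D : Connection k R) (f : R) (X Y : Derivation k R R) :
    D.torsion X (f • Y) = f • D.torsion X Y := by
  simp only [torsion, map_smul, LinearMap.smul_apply, D.leibniz, lie_smul_der, smul_sub]
  abel

/-- `∇ Tor` is a tensor. -/
def covTorsionHom (D : Connection k R) :
    Derivation k R R →ₗ[R] Derivation k R R →ₗ[R] Derivation k R R →ₗ[R] Derivation k R R where
  toFun X := LinearMap.mk₂ R (D.covTorsion X)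
    (fun Y Y' Z => by
      simp only [covTorsion, map_add, torsion_add_left]
      abel)
    (fun f Y Z => by
      simp only [covTorsion, torsion_smul_left, D.leibniz, torsion_add_left, smul_sub]
      abel)
    (fun Y Z Z' => by
      simp only [covTorsion, map_add, torsion_add_right]
      abel)
    (fun f Y Z => by
      simp only [covTorsion, torsion_smul_right, D.leibniz, torsion_add_right, smul_sub]
      abel)
  map_add' X X' := by
    ext1 Y
    ext1 Z
    simp only [LinearMap.mk₂_apply, LinearMap.add_apply, covTorsion, map_add, torsion_add_left,
      torsion_add_right]
    abel
  map_smul' f X := by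
    ext1 Y
    ext1 Z
    simp only [LinearMap.mk₂_apply, LinearMap.smul_apply, covTorsion, map_smul, torsion_smul_left,
      torsion_smul_right, smul_sub, RingHom.id_apply]

theorem covTorsionHom_apply (D : Connection k R) (X Y Z : Derivation k R R) :
    D.covTorsionHom X Y Z = D.covTorsion X Y Z := rfl

theorem torsion_of_isHorizontal {D : Connection k R} {Y Z : Derivation k R R}
    (hY : D.IsHorizontal Y) (hZ : D.IsHorizontal Z) : D.torsion Y Z = -⁅Y, Z⁆ := by
  rw [torsion, hZ Y, hY Z]
  simp

/-- The bridge between the Lie condition and the torsion: two of the three terms of ∇Tor contain a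
derivative of a horizontal field, and the torsion in the remaining one is minus the bracket. -/
theorem covTorsion_of_isHorizontal {D : Connection k R} {Y Z : Derivation k R R}
    (hY : D.IsHorizontal Y) (hZ : D.IsHorizontal Z) (X : Derivation k R R) :
    D.covTorsion X Y Z = -D.cov X ⁅Y, Z⁆ := by
  rw [covTorsion, hY X, hZ X, torsion_of_isHorizontal hY hZ]
  have h1 : D.torsion 0 Z = 0 := by simpa using D.torsion_smul_left 0 0 Z
  have h2 : D.torsion Y 0 = 0 := by simpa using D.torsion_smul_right 0 Y 0
  rw [h1, h2, map_neg, sub_zero, sub_zero]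

theorem HasParallelTorsion.isHorizontal_lie {D : Connection k R} (h : D.HasParallelTorsion)
    {Y Z : Derivation k R R} (hY : D.IsHorizontal Y) (hZ : D.IsHorizontal Z) :
    D.IsHorizontal ⁅Y, Z⁆ := by
  intro X
  have := covTorsion_of_isHorizontal hY hZ X
  rw [h] at this
  exact neg_eq_zero.mp this.symm

/-- Tensoriality of ∇Tor in all three arguments lets the vanishing be tested on generators, be they
horizontal fields or coordinate fields. -/
theorem hasParallelTorsion_of_span {D : Connection k R} {s : Set (Derivation k R R)}
    (hs : Submodule.span R s = ⊤)
    (h : ∀ X ∈ s, ∀ Y ∈ s, ∀ Z ∈ s, D.covTorsion X Y Z = 0) : D.HasParallelTorsion := by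
  have : D.covTorsionHom = 0 := by
    refine LinearMap.ext_on hs fun X hX => ?_
    refine LinearMap.ext_on hs fun Y hY => ?_
    exact LinearMap.ext_on hs fun Z hZ => h X hX Y hY Z hZ
  intro X Y Z
  rw [← covTorsionHom_apply, this]
  rfl

/-- If the horizontal vector fields span and are closed under the Lie bracket then the torsion is
parallel. -/
theorem hasParallelTorsion_of_lie {D : Connection k R}
    (hs : Submodule.span R {Y | D.IsHorizontal Y} = ⊤)
    (h : ∀ Y Z, D.IsHorizontal Y → D.IsHorizontal Z → D.IsHorizontal ⁅Y, Z⁆) :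
    D.HasParallelTorsion :=
  hasParallelTorsion_of_span hs fun X _ Y hY Z hZ => by
    rw [covTorsion_of_isHorizontal hY hZ, h Y Z hY hZ X, neg_zero]

end Connection

end Algebra

/-! ### Compatibility of rational functions, fields and connections with their germs. -/

section Germs

variable {A : Type*} [CommRing A] [Algebra ℂ A]

/-- Taking the germ of a regular function is a morphism of algebras. -/
def regularGermHom (x : Point A) : A →ₐ[ℂ] AnalyticGerm x where
  toFun := regularGerm x
  map_one' := Subtype.ext (congrArg Germ.ofFun (funext fun y => map_one y.eval))
  map_mul' a b := Subtype.ext (congrArg Germ.ofFun (funext fun y => map_mul y.eval a b))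
  map_zero' := Subtype.ext (congrArg Germ.ofFun (funext fun y => map_zero y.eval))
  map_add' a b := Subtype.ext (congrArg Germ.ofFun (funext fun y => map_add y.eval a b))
  commutes' c := by
    refine Subtype.ext ?_
    rw [Subalgebra.coe_algebraMap, Algebra.algebraMap_eq_smul_one (A := Germ (𝓝 x) ℂ)]
    refine congrArg Germ.ofFun (funext fun y => ?_)
    change y.eval _ = c * 1
    rw [y.eval.commutes, mul_one]
    rfl

theorem regularGermHom_apply (x : Point A) (a : A) : regularGermHom x a = regularGerm x a := rfl

variable {K : Type*} [Field K] [Algebra A K]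

namespace IsFunctionGerm

variable {x : Point A} {f f' : K} {g g' : AnalyticGerm x}

theorem regular [Nontrivial A] (a : A) : IsFunctionGerm x (algebraMap A K a) (regularGerm x a) := by
  refine ⟨a, 1, by simp, by simp, ?_⟩
  rw [← regularGermHom_apply x 1, map_one, mul_one]

theorem add (h : IsFunctionGerm x f g) (h' : IsFunctionGerm x f' g') :
    IsFunctionGerm x (f + f') (g + g') := by
  obtain ⟨b, c, hc, h1, h2⟩ := h
  obtain ⟨b', c', hc', h1', h2'⟩ := h'
  refine ⟨b * c' + b' * c, c * c', by simpa using ⟨hc, hc'⟩, ?_, ?_⟩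
  · simp only [map_add, map_mul, ← h1, ← h1']
    ring
  · simp only [← regularGermHom_apply, map_add, map_mul] at *
    rw [← h2, ← h2']
    ring

theorem mul (h : IsFunctionGerm x f g) (h' : IsFunctionGerm x f' g') :
    IsFunctionGerm x (f * f') (g * g') := by
  obtain ⟨b, c, hc, h1, h2⟩ := h
  obtain ⟨b', c', hc', h1', h2'⟩ := h'
  refine ⟨b * b', c * c', by simpa using ⟨hc, hc'⟩, ?_, ?_⟩
  · simp only [map_mul, ← h1, ← h1']
    ring
  · simp only [← regularGermHom_apply, map_mul] at *
    rw [← h2, ← h2']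
    ring

theorem neg (h : IsFunctionGerm x f g) : IsFunctionGerm x (-f) (-g) := by
  obtain ⟨b, c, hc, h1, h2⟩ := h
  refine ⟨-b, c, hc, by rw [map_neg, ← h1, neg_mul], ?_⟩
  simp only [← regularGermHom_apply, map_neg] at *
  rw [← h2]
  ring

theorem sub (h : IsFunctionGerm x f g) (h' : IsFunctionGerm x f' g') :
    IsFunctionGerm x (f - f') (g - g') := by
  rw [sub_eq_add_neg, sub_eq_add_neg]
  exact h.add h'.neg

theorem zero [Nontrivial A] : IsFunctionGerm x (0 : K) 0 := by
  have := regular (K := K) (x := x) 0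
  rwa [map_zero, ← regularGermHom_apply, map_zero] at this

theorem sum [Nontrivial A] {ι : Type*} (s : Finset ι) {f : ι → K} {g : ι → AnalyticGerm x}
    (h : ∀ i ∈ s, IsFunctionGerm x (f i) (g i)) :
    IsFunctionGerm x (∑ i ∈ s, f i) (∑ i ∈ s, g i) := by
  classical
  induction s using Finset.induction_on with
  | empty => simpa using zero
  | insert i s hi ih =>
    rw [Finset.sum_insert hi, Finset.sum_insert hi]
    exact (h i (Finset.mem_insert_self i s)).add
      (ih fun j hj => h j (Finset.mem_insert_of_mem hj))

/-- The denominator `c` may vanish at `x`; it is absorbed into the denominator of the fraction, so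
no division of germs occurs. -/
theorem of_mul_regular {c : A} (hc : algebraMap A K c ≠ 0)
    (h : IsFunctionGerm x (f * algebraMap A K c) (g * regularGerm x c)) :
    IsFunctionGerm x f g := by
  obtain ⟨b, e, he, h1, h2⟩ := h
  refine ⟨b, c * e, by simpa using ⟨hc, he⟩, ?_, ?_⟩
  · rw [map_mul, ← h1, mul_assoc]
  · simp only [← regularGermHom_apply, map_mul] at *
    rw [← h2, mul_assoc]

/-- `IsFieldGerm` only controls regular functions; the quotient rule, in the form X(f)c = X(fc) -
fX(c), extends the control to rational ones. -/
theorem derivation [Algebra ℂ K] {X : Derivation ℂ K K}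
    {V : Derivation ℂ (AnalyticGerm x) (AnalyticGerm x)}
    (hX : IsFieldGerm x X V) (h : IsFunctionGerm x f g) : IsFunctionGerm x (X f) (V g) := by
  have hfg := h
  obtain ⟨b, c, hc, h1, h2⟩ := h
  refine of_mul_regular hc ?_
  have e1 : X f * algebraMap A K c = X (algebraMap A K b) - f * X (algebraMap A K c) := by
    rw [← h1, X.leibniz, smul_eq_mul, smul_eq_mul]
    ring
  have e2 : V g * regularGerm x c = V (regularGerm x b) - g * V (regularGerm x c) := by
    rw [← h2, V.leibniz, smul_eq_mul, smul_eq_mul]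
    ring
  rw [e1, e2]
  exact (hX b).sub (hfg.mul (hX c))

end IsFunctionGerm

namespace IsFieldGerm

variable [Algebra ℂ K] {x : Point A} {X Y : Derivation ℂ K K}
  {V W : Derivation ℂ (AnalyticGerm x) (AnalyticGerm x)}

theorem add (hX : IsFieldGerm x X V) (hY : IsFieldGerm x Y W) : IsFieldGerm x (X + Y) (V + W) :=
  fun a => (hX a).add (hY a)

theorem sub (hX : IsFieldGerm x X V) (hY : IsFieldGerm x Y W) : IsFieldGerm x (X - Y) (V - W) :=
  fun a => (hX a).sub (hY a)

theorem smul {f : K} {g : AnalyticGerm x} (h : IsFunctionGerm x f g) (hX : IsFieldGerm x X V) :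
    IsFieldGerm x (f • X) (g • V) :=
  fun a => h.mul (hX a)

theorem zero [Nontrivial A] :
    IsFieldGerm x (0 : Derivation ℂ K K) (0 : Derivation ℂ (AnalyticGerm x) (AnalyticGerm x)) :=
  fun _ => IsFunctionGerm.zero

theorem sum [Nontrivial A] {ι : Type*} (s : Finset ι) {X : ι → Derivation ℂ K K}
    {V : ι → Derivation ℂ (AnalyticGerm x) (AnalyticGerm x)}
    (h : ∀ i ∈ s, IsFieldGerm x (X i) (V i)) :
    IsFieldGerm x (∑ i ∈ s, X i) (∑ i ∈ s, V i) := by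
  classical
  induction s using Finset.induction_on with
  | empty => simpa using zero
  | insert i s hi ih =>
    rw [Finset.sum_insert hi, Finset.sum_insert hi]
    exact (h i (Finset.mem_insert_self i s)).add
      (ih fun j hj => h j (Finset.mem_insert_of_mem hj))

theorem lie (hX : IsFieldGerm x X V) (hY : IsFieldGerm x Y W) :
    IsFieldGerm x ⁅X, Y⁆ ⁅V, W⁆ := fun a => by
  rw [Derivation.commutator_apply, Derivation.commutator_apply]
  exact ((hY a).derivation hX).sub ((hX a).derivation hY)

end IsFieldGerm

namespace IsConnectionGerm

variable [Algebra ℂ K] {x : Point A} {D : Connection ℂ K} {E : Connection ℂ (AnalyticGerm x)}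
  {X Y Z : Derivation ℂ K K} {U V W : Derivation ℂ (AnalyticGerm x) (AnalyticGerm x)}

theorem torsion (h : IsConnectionGerm x D E) (hX : IsFieldGerm x X U) (hY : IsFieldGerm x Y V) :
    IsFieldGerm x (D.torsion X Y) (E.torsion U V) :=
  ((h _ _ _ _ hX hY).sub (h _ _ _ _ hY hX)).sub (hX.lie hY)

theorem covTorsion (h : IsConnectionGerm x D E) (hX : IsFieldGerm x X U) (hY : IsFieldGerm x Y V)
    (hZ : IsFieldGerm x Z W) : IsFieldGerm x (D.covTorsion X Y Z) (E.covTorsion U V W) :=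
  ((h _ _ _ _ hX (h.torsion hY hZ)).sub (h.torsion (h _ _ _ _ hX hY) hZ)).sub
    (h.torsion hY (h _ _ _ _ hX hZ))

theorem curvature (h : IsConnectionGerm x D E) (hX : IsFieldGerm x X U) (hY : IsFieldGerm x Y V)
    (hZ : IsFieldGerm x Z W) : IsFieldGerm x (D.curvature X Y Z) (E.curvature U V W) :=
  ((h _ _ _ _ hX (h _ _ _ _ hY hZ)).sub (h _ _ _ _ hY (h _ _ _ _ hX hZ))).sub
    (h _ _ _ _ (hX.lie hY) hZ)

end IsConnectionGerm

end Germs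

/-! ### Integration and analytic families along rays. -/

section Frobenius

open unitInterval

variable {M : Type*} [NormedRing M] [NormedAlgebra ℂ M]

/-- The extension to the real line of a continuous function on the unit interval. -/
def extendIcc {G : Type*} [TopologicalSpace G] (c : C(I, G)) (s : ℝ) : G :=
  c (Set.projIcc 0 1 zero_le_one s)

theorem continuous_extendIcc {G : Type*} [TopologicalSpace G] (c : C(I, G)) :
    Continuous (extendIcc c) :=
  c.continuous.comp continuous_projIcc

theorem extendIcc_coe {G : Type*} [TopologicalSpace G] (c : C(I, G)) (t : I) :
    extendIcc c t = c t := by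
  rw [extendIcc, Set.projIcc_val]

variable (M) in
/-- Integration from `0`, as an operator on continuous functions on the unit interval. -/
def primitive : C(I, M) →L[ℂ] C(I, M) :=
  LinearMap.mkContinuous
    { toFun := fun c => ⟨fun t => ∫ s in (0 : ℝ)..t, extendIcc c s,
        (intervalIntegral.continuous_primitive
          (fun a b => (continuous_extendIcc c).intervalIntegrable a b) 0).comp
            continuous_subtype_val⟩
      map_add' := fun c d => by
        ext t
        exact intervalIntegral.integral_add ((continuous_extendIcc c).intervalIntegrable _ _)
          ((continuous_extendIcc d).intervalIntegrable _ _)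
      map_smul' := fun a c => by
        ext t
        exact intervalIntegral.integral_smul a _ } 1 (fun c => by
      rw [one_mul, ContinuousMap.norm_le _ (norm_nonneg c)]
      intro t
      refine (intervalIntegral.norm_integral_le_of_norm_le_const
        (C := ‖c‖) fun s _ => c.norm_coe_le_norm _).trans ?_
      have h0 := t.2.1
      have h1 := t.2.2
      rw [sub_zero, abs_of_nonneg h0]
      exact mul_le_of_le_one_right (norm_nonneg c) h1)

variable {E : Type*} [NormedAddCommGroup E] [NormedSpace ℂ E]

/-- The map `g ↦ (t ↦ tⁿ g)`. -/
def monomialCLM (G : Type*) [NormedAddCommGroup G] [NormedSpace ℂ G] (n : ℕ) : G →L[ℂ] C(I, G) :=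
  LinearMap.mkContinuous
    { toFun := fun g => ⟨fun t => (((t : ℝ) : ℂ) ^ n) • g, by fun_prop⟩
      map_add' := fun g h => by
        ext t
        simp
      map_smul' := fun a g => by
        ext t
        simp [smul_comm a] } 1 (fun g => by
      rw [one_mul, ContinuousMap.norm_le _ (norm_nonneg g)]
      intro t
      simp only [LinearMap.coe_mk, AddHom.coe_mk, ContinuousMap.coe_mk, norm_smul, norm_pow,
        Complex.norm_real, Real.norm_eq_abs]
      refine mul_le_of_le_one_left (norm_nonneg g) (pow_le_one₀ (abs_nonneg _) ?_)
      rw [abs_of_nonneg t.2.1]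
      exact t.2.2)

theorem norm_monomialCLM_le (G : Type*) [NormedAddCommGroup G] [NormedSpace ℂ G] (n : ℕ) :
    ‖monomialCLM G n‖ ≤ 1 :=
  LinearMap.mkContinuous_norm_le _ zero_le_one _

/-- An analytic function vanishing at the origin is, on each ray `t ↦ t z`, of the form `t γ_z(t)`
with `γ_z` depending analytically on `z`. -/
theorem exists_analyticAt_radial {G : Type*} [NormedAddCommGroup G] [NormedSpace ℂ G]
    [CompleteSpace G] {f : E → G} (hf : AnalyticAt ℂ f 0) (h0 : f 0 = 0) :
    ∃ γ : E → C(I, G), AnalyticAt ℂ γ 0 ∧ γ 0 = 0 ∧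
      ∀ᶠ z in 𝓝 (0 : E), ∀ t : I, ((t : ℝ) : ℂ) • γ z t = f (((t : ℝ) : ℂ) • z) := by
  obtain ⟨q, r, hq⟩ := hf
  -- On a ray, the degree n term is tⁿ qₙ(z), and dividing by t gives t^(n-1) qₙ(z). For n = 0 the
  -- truncated subtraction gives exponent 0, which is harmless because q₀ = f 0 = 0.
  let q' : FormalMultilinearSeries ℂ E C(I, G) := fun n =>
    (monomialCLM G (n - 1)).compContinuousMultilinearMap (q n)
  have hnorm : ∀ n, ‖q' n‖ ≤ ‖q n‖ := fun n =>
    ((monomialCLM G (n - 1)).norm_compContinuousMultilinearMap_le (q n)).trans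
      (mul_le_of_le_one_left (norm_nonneg _) (norm_monomialCLM_le G _))
  have hrad : q.radius ≤ q'.radius := by
    refine ENNReal.le_of_forall_nnreal_lt fun ρ hρ => ?_
    obtain ⟨C, -, hC⟩ := q.norm_mul_pow_le_of_lt_radius hρ
    exact q'.le_radius_of_bound C fun n =>
      (mul_le_mul_of_nonneg_right (hnorm n) (by positivity)).trans (hC n)
  have hpos : 0 < q'.radius := (hq.r_pos.trans_le hq.r_le).trans_le hrad
  have hq' := q'.hasFPowerSeriesOnBall hpos
  have hq0 : q 0 0 = 0 := by
    rw [← h0]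
    exact hq.hasFPowerSeriesAt.coeff_zero 0
  have hterm : ∀ (z : E) (t : I) (n : ℕ),
      ((t : ℝ) : ℂ) • (q' n (fun _ => z)) t = q n fun _ => ((t : ℝ) : ℂ) • z := by
    intro z t n
    have : (q' n (fun _ => z)) t = (((t : ℝ) : ℂ) ^ (n - 1)) • q n fun _ => z := rfl
    rw [this]
    rcases n with _ | n
    · have hz : ∀ v : Fin 0 → E, q 0 v = 0 := fun v => by rw [Subsingleton.elim v 0, hq0]
      rw [hz, hz, smul_zero, smul_zero]
    · rw [smul_smul, Nat.add_sub_cancel, ← pow_succ',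
        (q (n + 1)).map_smul_univ (fun _ => ((t : ℝ) : ℂ)) fun _ => z]
      simp
  refine ⟨q'.sum, hq'.analyticAt, ?_, ?_⟩
  · have : q' 0 0 = 0 := by
      change monomialCLM G (0 - 1) (q 0 0) = 0
      rw [hq0, map_zero]
    rw [← this]
    exact (hq'.hasFPowerSeriesAt.coeff_zero 0).symm
  · have h1 : Metric.eball (0 : E) q'.radius ∈ 𝓝 (0 : E) := Metric.eball_mem_nhds 0 hpos
    have h2 : Metric.eball (0 : E) r ∈ 𝓝 (0 : E) := Metric.eball_mem_nhds 0 hq.r_pos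
    filter_upwards [h1, h2] with z hz1 hz2 t
    have hs := hq'.hasSum hz1
    rw [zero_add] at hs
    have hs1 := ((ContinuousMap.evalCLM ℂ t).hasSum hs).const_smul ((t : ℝ) : ℂ)
    have htz : ((t : ℝ) : ℂ) • z ∈ Metric.eball (0 : E) r := by
      rw [Metric.mem_eball, edist_zero_right] at hz2 ⊢
      refine lt_of_le_of_lt ?_ hz2
      rw [enorm_smul]
      refine mul_le_of_le_one_left (by positivity) ?_
      rw [← ofReal_norm, Complex.norm_real, Real.norm_eq_abs, abs_of_nonneg t.2.1]
      exact ENNReal.ofReal_le_one.mpr t.2.2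
    have hs2 := hq.hasSum htz
    rw [zero_add] at hs2
    refine hs1.unique ?_
    convert hs2 using 2 with n
    exact hterm z t n

end Frobenius

/-! ### Radial differential equations solved by Volterra operators. -/

section Frobenius

open unitInterval

variable {M : Type*} [NormedRing M] [NormedAlgebra ℂ M]
  {E : Type*} [NormedAddCommGroup E] [NormedSpace ℂ E]

/-- The bounded operators on a normed space. -/
abbrev Op (X : Type*) [NormedAddCommGroup X] [NormedSpace ℂ X] := X →L[ℂ] X

theorem eventually_isUnit_one_add {X : Type*} [NormedAddCommGroup X] [NormedSpace ℂ X]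
    [CompleteSpace X] {L : E → Op X} (hL : AnalyticAt ℂ L 0) (hL0 : L 0 = 0) :
    ∀ᶠ z in 𝓝 (0 : E), IsUnit (1 + L z) := by
  have h : AnalyticAt ℂ (fun z => 1 + L z) 0 := analyticAt_const.add hL
  have hn : {T : Op X | IsUnit T} ∈ 𝓝 (1 + L 0) := by
    refine Units.isOpen.mem_nhds ?_
    simp [hL0]
  exact h.continuousAt hn

/-- Gives uniqueness for Volterra equations near the origin: invertible operators form an open set
containing 1. -/
theorem eventually_injective_one_add {X : Type*} [NormedAddCommGroup X] [NormedSpace ℂ X]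
    [CompleteSpace X] {L : E → Op X} (hL : AnalyticAt ℂ L 0) (hL0 : L 0 = 0) :
    ∀ᶠ z in 𝓝 (0 : E), ∀ d : X, d + L z d = 0 → d = 0 := by
  filter_upwards [eventually_isUnit_one_add hL hL0] with z hz d hd
  have h1 := congrArg (fun T : Op X => T d) (Ring.inverse_mul_cancel _ hz)
  have h2 : (1 + L z) d = 0 := hd
  simpa [h2] using h1.symm

/-- Inversion is analytic at 1 in the Banach algebra of operators, so solutions of a Volterra
equation depend analytically on the parameter. -/
theorem exists_analyticAt_one_add_inverse {X : Type*} [NormedAddCommGroup X] [NormedSpace ℂ X]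
    [CompleteSpace X] {L : E → Op X} (hL : AnalyticAt ℂ L 0) (hL0 : L 0 = 0) (x : X) :
    ∃ c : E → X, AnalyticAt ℂ c 0 ∧ c 0 = x ∧ ∀ᶠ z in 𝓝 (0 : E), c z + L z (c z) = x := by
  have h : AnalyticAt ℂ (fun z => 1 + L z) 0 := analyticAt_const.add hL
  have h1 : AnalyticAt ℂ (fun z => Ring.inverse (1 + L z)) 0 := by
    refine AnalyticAt.fun_comp (g := Ring.inverse) ?_ h
    have : 1 + L 0 = ((1 : (Op X)ˣ) : Op X) := by simp [hL0]
    rw [this]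
    exact analyticAt_inverse _
  refine ⟨fun z => Ring.inverse (1 + L z) x, ((ContinuousLinearMap.apply ℂ X x).analyticAt _).comp h1,
    by simp [hL0], ?_⟩
  filter_upwards [eventually_isUnit_one_add hL hL0] with z hz
  exact congrArg (fun T : Op X => T x) (Ring.mul_inverse_cancel _ hz)

variable (M) in
/-- The Volterra operator `c ↦ (t ↦ ∫₀ᵗ γ c)`. -/
def volterra : C(I, M) →L[ℂ] Op C(I, M) :=
  LinearMap.mkContinuous₂ (LinearMap.mk₂ ℂ (fun γ c => primitive M (γ * c))
    (fun γ γ' c => by rw [add_mul, map_add]) (fun a γ c => by rw [smul_mul_assoc, map_smul])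
    (fun γ c c' => by rw [mul_add, map_add]) (fun a γ c => by rw [mul_smul_comm, map_smul]))
    ‖primitive M‖ (fun γ c => by
      rw [mul_assoc]
      exact ((primitive M).le_opNorm _).trans
        (mul_le_mul_of_nonneg_left (norm_mul_le γ c) (norm_nonneg _)))

theorem volterra_apply (γ c : C(I, M)) (t : I) :
    volterra M γ c t = ∫ s in (0 : ℝ)..t, extendIcc γ s * extendIcc c s := rfl

theorem analyticAt_volterra {γ : E → C(I, M)} (hγ : AnalyticAt ℂ γ 0) :
    AnalyticAt ℂ (fun z => volterra M (γ z)) 0 :=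
  ((volterra M).analyticAt _).comp hγ

theorem _root_.HasDerivAt.comp_ofReal_vector {G : Type*} [NormedAddCommGroup G] [NormedSpace ℂ G]
    {f : ℂ → G} {f' : G} {s : ℝ} (h : HasDerivAt f f' s) :
    HasDerivAt (fun r : ℝ => f r) f' s := by
  have := HasDerivAt.scomp s h Complex.ofRealCLM.hasDerivAt
  rw [Complex.ofRealCLM_apply, Complex.ofReal_one, one_smul] at this
  exact this

variable [CompleteSpace M]

/-- Uniqueness of analytic solutions of the singular equation `(z · ∂ + 1 + B) W = 0`. -/
theorem eventually_eq_zero_of_euler {B W : E → M} (hB : AnalyticAt ℂ B 0) (hB0 : B 0 = 0)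
    (hW : ∀ᶠ z in 𝓝 (0 : E), DifferentiableAt ℂ W z)
    (h : ∀ᶠ z in 𝓝 (0 : E), fderiv ℂ W z z + W z + B z * W z = 0) :
    ∀ᶠ z in 𝓝 (0 : E), W z = 0 := by
  obtain ⟨γ, hγ, hγ0, hγB⟩ := exists_analyticAt_radial hB hB0
  have hinj := eventually_injective_one_add (analyticAt_volterra hγ) (by rw [hγ0, map_zero])
  obtain ⟨δ, hδ, hball⟩ := Metric.eventually_nhds_iff_ball.mp (hW.and (h.and (hγB.and hinj)))
  refine Metric.eventually_nhds_iff_ball.mpr ⟨δ, hδ, fun z hz => ?_⟩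
  obtain ⟨-, -, hz3, hz4⟩ := hball z hz
  have hmem : ∀ s ∈ Set.Icc (0 : ℝ) 1, (s : ℂ) • z ∈ Metric.ball (0 : E) δ := by
    intro s hs
    rw [mem_ball_zero_iff] at hz ⊢
    refine lt_of_le_of_lt ?_ hz
    rw [norm_smul, Complex.norm_real, Real.norm_eq_abs, abs_of_nonneg hs.1]
    exact mul_le_of_le_one_left (norm_nonneg z) hs.2
  -- The factor s desingularizes the equation: the derivative of s W(sz) is ∂W(sz)(sz) + W(sz) =
  -- -B(sz) W(sz), and B(sz) = s γ_z(s), so φ' = -γ_z φ with φ(0) = 0.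
  let φ : ℝ → M := fun s => (s : ℂ) • W ((s : ℂ) • z)
  have hφ : ∀ s ∈ Set.Icc (0 : ℝ) 1, HasDerivAt φ (-(extendIcc (γ z) s * φ s)) s := by
    intro s hs
    obtain ⟨h1, h2, -, -⟩ := hball _ (hmem s hs)
    have hd1 : HasDerivAt (fun a : ℂ => a • z) z (s : ℂ) := by
      simpa using (hasDerivAt_id (s : ℂ)).smul_const z
    have hd2 : HasDerivAt (fun a : ℂ => a • W (a • z))
        ((s : ℂ) • fderiv ℂ W ((s : ℂ) • z) z + (1 : ℂ) • W ((s : ℂ) • z)) (s : ℂ) :=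
      (hasDerivAt_id (s : ℂ)).smul (h1.hasFDerivAt.comp_hasDerivAt (s : ℂ) hd1)
    have hd3 := hd2.comp_ofReal_vector
    have e1 : (s : ℂ) • extendIcc (γ z) s = B ((s : ℂ) • z) := by
      rw [extendIcc, Set.projIcc_of_mem _ hs]
      exact hz3 ⟨s, hs⟩
    rw [map_smul] at h2
    rw [one_smul, eq_neg_of_add_eq_zero_left h2, ← e1, smul_mul_assoc, ← mul_smul_comm] at hd3
    exact hd3
  let φI : C(I, M) := ⟨fun t => φ t, continuous_iff_continuousAt.mpr fun t =>
    (hφ t t.2).continuousAt.comp continuous_subtype_val.continuousAt⟩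
  have hext : ∀ s ∈ Set.Icc (0 : ℝ) 1, extendIcc φI s = φ s := by
    intro s hs
    rw [extendIcc, Set.projIcc_of_mem _ hs]
    rfl
  -- Integrating φ' = -γ_z φ from 0 puts φ in the kernel of the injective operator 1 + `volterra M
  -- (γ z)`.
  have hker : φI + volterra M (γ z) φI = 0 := by
    ext t
    change φ t + volterra M (γ z) φI t = 0
    have hsub : Set.uIcc (0 : ℝ) t ⊆ Set.Icc 0 1 := by
      rw [Set.uIcc_of_le t.2.1]
      exact Set.Icc_subset_Icc le_rfl t.2.2
    have hF : ∫ s in (0 : ℝ)..t, -(extendIcc (γ z) s * extendIcc φI s) = φ t - φ 0 := by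
      refine intervalIntegral.integral_eq_sub_of_hasDerivAt (fun s hs => ?_) ?_
      · rw [hext s (hsub hs)]
        exact hφ s (hsub hs)
      · exact ((continuous_extendIcc _).mul (continuous_extendIcc _)).neg.intervalIntegrable _ _
    rw [intervalIntegral.integral_neg] at hF
    have hφ0 : φ 0 = 0 := by simp [φ]
    rw [hφ0, sub_zero] at hF
    rw [volterra_apply, ← hF, neg_add_cancel]
  have hzero : φI = 0 := hz4 φI hker
  have := congrArg (fun c : C(I, M) => c 1) hzero
  simpa [φI, φ] using this

/-- Existence of analytic solutions of the singular equation `z · ∂ u = -B u`. -/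
theorem exists_analyticAt_euler {B : E → M} (hB : AnalyticAt ℂ B 0) (hB0 : B 0 = 0) :
    ∃ u : E → M, AnalyticAt ℂ u 0 ∧ u 0 = 1 ∧
      ∀ᶠ z in 𝓝 (0 : E), fderiv ℂ u z z = -(B z * u z) := by
  obtain ⟨γ, hγ, hγ0, hγB⟩ := exists_analyticAt_radial hB hB0
  have hL0 : volterra M (γ 0) = 0 := by rw [hγ0, map_zero]
  -- The curve `c z` on [0,1] solves c + ∫γ_z c = 1, that is c' = -γ_z c with c(0) = 1. The desired
  -- solution is its endpoint, u(z) = c_z(1).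
  obtain ⟨c, hcan, hc0, hc⟩ := exists_analyticAt_one_add_inverse (analyticAt_volterra hγ) hL0 1
  have hker := eventually_injective_one_add (analyticAt_volterra hγ) hL0
  have huan : AnalyticAt ℂ (fun z => c z 1) 0 :=
    (ContinuousLinearMap.analyticAt (ContinuousMap.evalCLM ℂ (1 : I) : C(I, M) →L[ℂ] M) (c 0)).comp
      hcan
  refine ⟨fun z => c z 1, huan, by simp [hc0], ?_⟩
  obtain ⟨δ, hδ, hball⟩ := Metric.eventually_nhds_iff_ball.mp
    (huan.eventually_analyticAt.and (hγB.and (hc.and hker)))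
  have hcz : ∀ z ∈ Metric.ball (0 : E) δ, c z + volterra M (γ z) (c z) = 1 :=
    fun z hz => (hball z hz).2.2.1
  have hinj : ∀ z ∈ Metric.ball (0 : E) δ, ∀ d : C(I, M), d + volterra M (γ z) d = 1 → d = c z := by
    intro z hz d hd
    refine sub_eq_zero.mp ((hball z hz).2.2.2 _ ?_)
    rw [map_sub, sub_add_sub_comm, hd, hcz z hz, sub_self]
  have hmem : ∀ z ∈ Metric.ball (0 : E) δ, ∀ s : I, ((s : ℝ) : ℂ) • z ∈ Metric.ball (0 : E) δ := by
    intro z hz s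
    rw [mem_ball_zero_iff] at hz ⊢
    refine lt_of_le_of_lt ?_ hz
    rw [norm_smul, Complex.norm_real, Real.norm_eq_abs, abs_of_nonneg s.2.1]
    exact mul_le_of_le_one_left (norm_nonneg z) s.2.2
  -- The endpoint for sz is the value at time s for z: t ↦ c_z(st) solves the Volterra equation of
  -- sz, whose solution is unique. Hence u(sz) = c_z(s), and differentiating u radially means
  -- differentiating c_z.
  have hscale : ∀ z ∈ Metric.ball (0 : E) δ, ∀ s : I, c (((s : ℝ) : ℂ) • z) 1 = c z s := by
    intro z hz s
    let d : C(I, M) := (c z).comp ⟨fun t => s * t, by fun_prop⟩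
    have hd : d = c (((s : ℝ) : ℂ) • z) := by
      refine hinj _ (hmem z hz s) d ?_
      ext t
      have h1 := congrArg (fun e : C(I, M) => e (s * t)) (hcz z hz)
      change c z (s * t) + volterra M (γ z) (c z) (s * t) = 1 at h1
      change c z (s * t) + volterra M (γ (((s : ℝ) : ℂ) • z)) d t = 1
      rw [← h1]
      congr 1
      rw [volterra_apply, volterra_apply]
      have h2 := intervalIntegral.smul_integral_comp_mul_left (a := 0) (b := (t : ℝ))
        (fun r => extendIcc (γ z) r * extendIcc (c z) r) (s : ℝ)
      rw [mul_zero] at h2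
      rw [Set.Icc.coe_mul, ← h2, ← intervalIntegral.integral_smul]
      refine intervalIntegral.integral_congr_ae (Eventually.of_forall fun r hr => ?_)
      rw [Set.uIoc_of_le t.2.1] at hr
      have hrI : r ∈ Set.Icc (0 : ℝ) 1 := ⟨hr.1.le, hr.2.trans t.2.2⟩
      have e1 : extendIcc d r = extendIcc (c z) (s * r) := by
        have h3 := extendIcc_coe d ⟨r, hrI⟩
        have h4 := extendIcc_coe (c z) (s * ⟨r, hrI⟩)
        exact h3.trans h4.symm
      -- Both r γ_{sz}(r) and sr γ_z(sr) equal B(rsz); cancelling r is allowed because the integral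
      -- runs over a half-open interval excluding 0.
      have e2 : extendIcc (γ (((s : ℝ) : ℂ) • z)) r = (s : ℝ) • extendIcc (γ z) (s * r) := by
        have h3 := extendIcc_coe (γ (((s : ℝ) : ℂ) • z)) ⟨r, hrI⟩
        have h4 := extendIcc_coe (γ z) (s * ⟨r, hrI⟩)
        have h5 := (hball _ (hmem z hz s)).2.1 ⟨r, hrI⟩
        have h6 := (hball z hz).2.1 (s * ⟨r, hrI⟩)
        rw [Set.Icc.coe_mul] at h4 h6
        simp only at h3 h4 h5 h6
        rw [smul_smul, mul_comm, ← Complex.ofReal_mul, ← h6, ← h4, ← h3, Complex.ofReal_mul,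
          mul_comm, mul_smul] at h5
        have hr0 : (r : ℂ) ≠ 0 := Complex.ofReal_ne_zero.mpr hr.1.ne'
        have := smul_right_injective M hr0 h5
        simpa using this
      simp only [e1, e2, smul_mul_assoc]
    rw [← hd]
    change c z (s * 1) = c z s
    rw [mul_one]
  -- Writing y = (1/2)z with z = 2y places y at time 1/2, interior to [0,1], where the curve has a
  -- two-sided derivative. This is the reason for halving the radius.
  refine Metric.eventually_nhds_iff_ball.mpr ⟨δ / 2, by positivity, fun y hy => ?_⟩
  have hz : (2 : ℂ) • y ∈ Metric.ball (0 : E) δ := by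
    rw [mem_ball_zero_iff] at hy ⊢
    rw [norm_smul, Complex.norm_ofNat]
    linarith
  have hyδ : y ∈ Metric.ball (0 : E) δ := Metric.ball_subset_ball (by linarith) hy
  set z := (2 : ℂ) • y with hzdef
  have hhalf : (((1 / 2 : ℝ)) : ℂ) • z = y := by
    rw [hzdef, smul_smul]
    norm_num
  have hhI : (1 / 2 : ℝ) ∈ Set.Icc (0 : ℝ) 1 := by norm_num
  have hd1 : HasDerivAt (fun s : ℝ => ∫ r in (0 : ℝ)..s, extendIcc (γ z) r * extendIcc (c z) r)
      (extendIcc (γ z) (1 / 2) * extendIcc (c z) (1 / 2)) (1 / 2 : ℝ) := by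
    have hcont : Continuous fun r => extendIcc (γ z) r * extendIcc (c z) r :=
      (continuous_extendIcc _).mul (continuous_extendIcc _)
    exact intervalIntegral.integral_hasDerivAt_right (hcont.intervalIntegrable _ _)
      (hcont.stronglyMeasurableAtFilter _ _) hcont.continuousAt
  have hd2 : HasDerivAt (fun s : ℝ => c ((s : ℂ) • z) 1)
      (-(extendIcc (γ z) (1 / 2) * extendIcc (c z) (1 / 2))) (1 / 2 : ℝ) := by
    refine (hd1.const_sub 1).congr_of_eventuallyEq ?_
    filter_upwards [Icc_mem_nhds (a := (0 : ℝ)) (b := 1) (x := 1 / 2) (by norm_num)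
      (by norm_num)] with s hs
    have h1 := congrArg (fun e : C(I, M) => e ⟨s, hs⟩) (hcz z hz)
    have h2 := hscale z hz ⟨s, hs⟩
    simp only at h2
    rw [h2]
    exact eq_sub_of_add_eq h1
  have hd3 : HasDerivAt (fun s : ℝ => c ((s : ℂ) • z) 1)
      (fderiv ℂ (fun z => c z 1) y z) (1 / 2 : ℝ) := by
    have hda := (hball y hyδ).1.differentiableAt.hasFDerivAt
    rw [← hhalf] at hda
    have hd4 : HasDerivAt (fun a : ℂ => a • z) z (((1 / 2 : ℝ)) : ℂ) := by
      simpa using (hasDerivAt_id (((1 / 2 : ℝ)) : ℂ)).smul_const z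
    have := (hda.comp_hasDerivAt _ hd4).comp_ofReal_vector
    rwa [hhalf] at this
  have heq := hd3.unique hd2
  have h5 := (hball z hz).2.1 ⟨1 / 2, hhI⟩
  have h6 := hscale z hz ⟨1 / 2, hhI⟩
  have h7 := extendIcc_coe (γ z) ⟨1 / 2, hhI⟩
  have h8 := extendIcc_coe (c z) ⟨1 / 2, hhI⟩
  simp only at h5 h6 h7 h8
  rw [hhalf] at h5 h6
  rw [h7, h8, ← h6, hzdef, map_smul, ← hzdef] at heq
  rw [← h5, smul_mul_assoc, ← smul_neg, ← heq, smul_smul]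
  norm_num

end Frobenius

/-! ### Parallel sections of flat analytic connection forms. -/

section Frobenius

variable {M : Type*} [NormedRing M] [NormedAlgebra ℂ M] [CompleteSpace M]
  {E : Type*} [NormedAddCommGroup E] [NormedSpace ℂ E]

theorem analyticAt_clm_apply {G H : Type*} [NormedAddCommGroup G] [NormedSpace ℂ G]
    [NormedAddCommGroup H] [NormedSpace ℂ H] {f : E → G →L[ℂ] H} {g : E → G} {z : E}
    (hf : AnalyticAt ℂ f z) (hg : AnalyticAt ℂ g z) : AnalyticAt ℂ (fun y => f y (g y)) z :=
  AnalyticAt.comp (g := fun q : (G →L[ℂ] H) × G => q.1 q.2) (f := fun y => (f y, g y))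
    ((ContinuousLinearMap.id ℂ (G →L[ℂ] H)).analyticAt_bilinear (f z, g z)) (hf.prod hg)

/-- The Frobenius theorem for linear systems: a flat analytic connection form has a local analytic
fundamental solution. -/
theorem exists_analyticAt_parallel {Γ : E → E →L[ℂ] M} (hΓ : AnalyticAt ℂ Γ 0)
    (hflat : ∀ᶠ z in 𝓝 (0 : E), ∀ v w,
      fderiv ℂ Γ z v w - fderiv ℂ Γ z w v + (Γ z v * Γ z w - Γ z w * Γ z v) = 0) :
    ∃ u : E → M, AnalyticAt ℂ u 0 ∧ u 0 = 1 ∧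
      ∀ v, ∀ᶠ z in 𝓝 (0 : E), fderiv ℂ u z v = -(Γ z v * u z) := by
  have hB : AnalyticAt ℂ (fun z => Γ z z) 0 := analyticAt_clm_apply hΓ analyticAt_id
  obtain ⟨u, hu, hu0, hEu⟩ := exists_analyticAt_euler hB (by simp)
  refine ⟨u, hu, hu0, fun v => ?_⟩
  -- The defect W = ∂_v u + Γ(v)u satisfies the homogeneous equation z·∂W + W + Γ(z)W = 0:
  -- differentiate the radial equation for u in the direction v, then use the symmetry of the second
  -- derivative and flatness in the directions z, v. Uniqueness then gives W = 0.
  have hW : ∀ᶠ z in 𝓝 (0 : E), fderiv ℂ u z v + Γ z v * u z = 0 := by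
    have hWd : ∀ z, AnalyticAt ℂ u z → AnalyticAt ℂ Γ z →
        HasFDerivAt (fun z => fderiv ℂ u z v + Γ z v * u z)
          ((fderiv ℂ (fderiv ℂ u) z).flip v +
            (Γ z v • fderiv ℂ u z + ((fderiv ℂ Γ z).flip v).smulRight (u z))) z := by
      intro z hz hz'
      have h1 : HasFDerivAt (fun z => fderiv ℂ u z v) ((fderiv ℂ (fderiv ℂ u) z).flip v) z := by
        simpa using hz.fderiv.differentiableAt.hasFDerivAt.clm_apply (hasFDerivAt_const v z)
      have h2 : HasFDerivAt (fun z => Γ z v) ((fderiv ℂ Γ z).flip v) z := by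
        simpa using hz'.differentiableAt.hasFDerivAt.clm_apply (hasFDerivAt_const v z)
      have h3 := h2.mul' hz.differentiableAt.hasFDerivAt
      exact h1.add h3
    refine eventually_eq_zero_of_euler hB (by simp) ?_ ?_
    · filter_upwards [hu.eventually_analyticAt, hΓ.eventually_analyticAt] with z h1 h2
      exact (hWd z h1 h2).differentiableAt
    · filter_upwards [hu.eventually_analyticAt, hΓ.eventually_analyticAt, hflat,
        hEu.eventually_nhds] with z h1 h2 hf he
      rw [(hWd z h1 h2).fderiv]
      have hd1 : HasFDerivAt (fun z => fderiv ℂ u z z)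
          ((fderiv ℂ u z) + (fderiv ℂ (fderiv ℂ u) z).flip z) z := by
        simpa using h1.fderiv.differentiableAt.hasFDerivAt.clm_apply (hasFDerivAt_id z)
      have hd2 : HasFDerivAt (fun z => Γ z z) (Γ z + (fderiv ℂ Γ z).flip z) z := by
        simpa using h2.differentiableAt.hasFDerivAt.clm_apply (hasFDerivAt_id z)
      have hd3 := (hd2.mul' h1.differentiableAt.hasFDerivAt).neg
      have hd4 := hd1.unique (hd3.congr_of_eventuallyEq he)
      have hd5 := congrArg (fun T : E →L[ℂ] M => T v) hd4
      have hsymm : fderiv ℂ (fderiv ℂ u) z v z = fderiv ℂ (fderiv ℂ u) z z v :=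
        (h1.contDiffAt (n := 2)).isSymmSndFDerivAt (by simp) v z
      have hez := he.self_of_nhds
      have hfz := congrArg (· * u z) (hf z v)
      simp at hd5 hfz ⊢
      rw [hsymm] at hd5
      rw [hez, eq_sub_of_add_eq' hd5, ← hfz]
      noncomm_ring
  filter_upwards [hW] with z hz
  exact eq_neg_of_add_eq_zero_left hz

end Frobenius

/-! ### The ring of germs of analytic functions at the origin. -/

section Local

/-- Shifting the power series by one degree leaves one argument unfilled; the shifted series sums to
G, and filling in z recovers every term but the constant one. -/
theorem exists_analyticAt_hadamard {E : Type*} [NormedAddCommGroup E] [NormedSpace ℂ E]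
    {F : E → ℂ} (hF : AnalyticAt ℂ F 0) :
    ∃ G : E → E →L[ℂ] ℂ, AnalyticAt ℂ G 0 ∧ ∀ᶠ z in 𝓝 (0 : E), F z = F 0 + G z z := by
  obtain ⟨q, r, hq⟩ := hF
  have hpos : 0 < q.shift.radius := by
    rw [q.radius_shift]
    exact hq.r_pos.trans_le hq.r_le
  have hq' := q.shift.hasFPowerSeriesOnBall hpos
  refine ⟨q.shift.sum, hq'.analyticAt, ?_⟩
  filter_upwards [Metric.eball_mem_nhds (0 : E) hpos, Metric.eball_mem_nhds (0 : E) hq.r_pos]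
    with z hz1 hz2
  have hs := (ContinuousLinearMap.apply ℂ ℂ z).hasSum (hq'.hasSum hz1)
  have hs2 := hq.hasSum hz2
  rw [zero_add] at hs hs2
  have hs3 := (hasSum_nat_add_iff' 1).mpr hs2
  have h0 : q 0 (fun _ => z) = F 0 := hq.hasFPowerSeriesAt.coeff_zero _
  rw [Finset.sum_range_one, h0] at hs3
  have hterm : ∀ n : ℕ, (ContinuousLinearMap.apply ℂ ℂ z) (q.shift n fun _ => z) =
      q (n + 1) fun _ => z := by
    intro n
    change q (n + 1) (Fin.snoc (fun _ => z) z) = _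
    congr 1
    ext i
    refine Fin.lastCases ?_ (fun j => ?_) i <;> simp
  simp only [hterm] at hs
  rw [← sub_eq_iff_eq_add']
  exact hs3.unique hs

/-- How near t = 0 each restriction vanishes may depend on the line. On a fixed ball where F is
analytic, each line cuts out a convex set, and the identity theorem in one variable carries the
vanishing from t = 0 to t = 1. -/
theorem eventually_eq_zero_of_order {E : Type*} [NormedAddCommGroup E] [NormedSpace ℂ E]
    {F : E → ℂ} (hF : AnalyticAt ℂ F 0)
    (h : ∀ z : E, ∀ᶠ t in 𝓝 (0 : ℂ), F (t • z) = 0) : ∀ᶠ z in 𝓝 (0 : E), F z = 0 := by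
  obtain ⟨δ, hδ, hball⟩ := Metric.eventually_nhds_iff_ball.mp hF.eventually_analyticAt
  refine Metric.eventually_nhds_iff_ball.mpr ⟨δ, hδ, fun z hz => ?_⟩
  let l : ℂ →L[ℂ] E := (ContinuousLinearMap.id ℂ ℂ).smulRight z
  have hl : ∀ t, l t = t • z := fun t => rfl
  have hconv : Convex ℝ (l ⁻¹' Metric.ball (0 : E) δ) :=
    (convex_ball (0 : E) δ).linear_preimage (l.restrictScalars ℝ).toLinearMap
  have han : AnalyticOnNhd ℂ (fun t => F (l t)) (l ⁻¹' Metric.ball (0 : E) δ) := fun t ht =>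
    (hball _ ht).comp_of_eq (l.analyticAt t) rfl
  have := han.eqOn_zero_of_preconnected_of_eventuallyEq_zero hconv.isPreconnected
    (z₀ := 0) (by simp [hδ]) (h z) (x := 1) (by simpa [hl] using hz)
  simpa [hl] using this

variable (κ : Type) [Fintype κ]

/-- Functions on `ℂ^κ` analytic at the origin. -/
def analyticFunctions : Subalgebra ℂ ((κ → ℂ) → ℂ) where
  carrier := {F | AnalyticAt ℂ F 0}
  mul_mem' := fun hF hG => AnalyticAt.mul hF hG
  add_mem' := fun hF hG => AnalyticAt.add hF hG
  algebraMap_mem' := fun _ => analyticAt_const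

/-- Passing to the germ at a point is a morphism of algebras. -/
def germHom {P : Type*} (l : Filter P) : (P → ℂ) →ₐ[ℂ] Germ l ℂ where
  toFun F := (F : Germ l ℂ)
  map_one' := rfl
  map_mul' _ _ := rfl
  map_zero' := rfl
  map_add' _ _ := rfl
  commutes' c := by
    rw [Algebra.algebraMap_eq_smul_one (A := Germ l ℂ), Algebra.algebraMap_eq_smul_one]
    rfl

/-- The ring of germs at the origin of analytic functions on `ℂ^κ`. -/
def LocalRing : Subalgebra ℂ (Germ (𝓝 (0 : κ → ℂ)) ℂ) :=
  (analyticFunctions κ).map (germHom _)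

variable {κ}

namespace LocalRing

/-- The germ of an analytic function. -/
def mk : analyticFunctions κ →ₐ[ℂ] LocalRing κ :=
  ((germHom (𝓝 (0 : κ → ℂ))).comp (analyticFunctions κ).val).codRestrict _ fun F =>
    ⟨F, F.2, rfl⟩

theorem mk_surjective : Function.Surjective (mk (κ := κ)) := by
  rintro ⟨_, F, hF, rfl⟩
  exact ⟨⟨F, hF⟩, rfl⟩

theorem mk_eq_mk {F G : analyticFunctions κ} :
    mk F = mk G ↔ ∀ᶠ z in 𝓝 (0 : κ → ℂ), F.1 z = G.1 z := by
  rw [Subtype.ext_iff]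
  exact Germ.coe_eq

theorem mk_eq_zero {F : analyticFunctions κ} :
    mk F = 0 ↔ ∀ᶠ z in 𝓝 (0 : κ → ℂ), F.1 z = 0 := by
  rw [← map_zero mk, mk_eq_mk]
  rfl

/-- The value at the origin. -/
def value : LocalRing κ →+* ℂ :=
  (Germ.valueRingHom (X := κ → ℂ) (E := ℂ) (x := 0)).comp (LocalRing κ).val.toRingHom

theorem value_mk (F : analyticFunctions κ) : value (mk F) = F.1 0 := rfl

theorem isUnit_of_value_ne_zero {g : LocalRing κ} (hg : value g ≠ 0) : IsUnit g := by
  obtain ⟨F, rfl⟩ := mk_surjective g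
  rw [value_mk] at hg
  refine IsUnit.of_mul_eq_one (mk ⟨fun z => (F.1 z)⁻¹, AnalyticAt.inv F.2 hg⟩) ?_
  rw [← map_mul, ← map_one mk, mk_eq_mk]
  filter_upwards [AnalyticAt.continuousAt F.2 |>.eventually_ne hg] with z hz
  exact mul_inv_cancel₀ hz

instance : Nontrivial (LocalRing κ) := value.domain_nontrivial

/-- If F is nonzero at a point of a small ball, G vanishes near that point, hence on the whole ball
by the identity theorem. -/
instance : NoZeroDivisors (LocalRing κ) where
  eq_zero_or_eq_zero_of_mul_eq_zero {g h} hgh := by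
    obtain ⟨F, rfl⟩ := mk_surjective g
    obtain ⟨G, rfl⟩ := mk_surjective h
    rw [← map_mul, mk_eq_zero] at hgh
    rw [mk_eq_zero, mk_eq_zero]
    have hF : AnalyticAt ℂ F.1 0 := F.2
    have hG : AnalyticAt ℂ G.1 0 := G.2
    obtain ⟨δ, hδ, hball⟩ := Metric.eventually_nhds_iff_ball.mp
      (hgh.and (hF.eventually_analyticAt.and hG.eventually_analyticAt))
    by_cases h0 : ∀ z ∈ Metric.ball (0 : κ → ℂ) δ, F.1 z = 0
    · exact Or.inl (Metric.eventually_nhds_iff_ball.mpr ⟨δ, hδ, h0⟩)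
    · push Not at h0
      obtain ⟨w, hw, hFw⟩ := h0
      have hne := (hball w hw).2.1.continuousAt.eventually_ne hFw
      have hGw : G.1 =ᶠ[𝓝 w] 0 := by
        filter_upwards [hne, Metric.isOpen_ball.mem_nhds hw] with z hz hzb
        exact (mul_eq_zero.mp (hball z hzb).1).resolve_left hz
      have han : AnalyticOnNhd ℂ G.1 (Metric.ball 0 δ) := fun z hz => (hball z hz).2.2
      have := han.eqOn_zero_of_preconnected_of_eventuallyEq_zero
        (convex_ball (0 : κ → ℂ) δ).isPreconnected hw hGw
      exact Or.inr (Metric.eventually_nhds_iff_ball.mpr ⟨δ, hδ, fun z hz => this hz⟩)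

instance : IsDomain (LocalRing κ) := NoZeroDivisors.to_isDomain _

/-- The coordinate germs. -/
def coord (i : κ) : LocalRing κ :=
  mk ⟨fun z => z i, (ContinuousLinearMap.proj (R := ℂ) (φ := fun _ : κ => ℂ) i).analyticAt 0⟩

variable [DecidableEq κ]

/-- Partial derivatives of analytic functions. -/
def partialFun (i : κ) (F : analyticFunctions κ) : analyticFunctions κ :=
  ⟨fun z => fderiv ℂ F.1 z (Pi.single i 1), analyticAt_clm_apply (AnalyticAt.fderiv F.2)
    analyticAt_const⟩

/-- Makes `pderiv` independent of the representatives that `Function.surjInv` selects. -/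
theorem mk_partialFun_congr (i : κ) {F G : analyticFunctions κ} (h : mk F = mk G) :
    mk (partialFun i F) = mk (partialFun i G) := by
  rw [mk_eq_mk] at h ⊢
  have h' : F.1 =ᶠ[𝓝 0] G.1 := h
  filter_upwards [h'.fderiv (𝕜 := ℂ)] with z hz
  exact congrArg (fun T : (κ → ℂ) →L[ℂ] ℂ => T (Pi.single i 1)) hz

/-- Partial derivatives of germs of analytic functions. -/
def pderiv (i : κ) : Derivation ℂ (LocalRing κ) (LocalRing κ) :=
  Derivation.mk'
    { toFun := fun g => mk (partialFun i (Function.surjInv mk_surjective g))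
      map_add' := fun g h => by
        rw [← map_add]
        refine (mk_partialFun_congr i (G := Function.surjInv mk_surjective g +
          Function.surjInv mk_surjective h) ?_).trans ?_
        · rw [map_add]
          simp only [Function.surjInv_eq mk_surjective]
        · rw [mk_eq_mk]
          filter_upwards [(AnalyticAt.eventually_analyticAt (Function.surjInv mk_surjective g).2),
            (AnalyticAt.eventually_analyticAt (Function.surjInv mk_surjective h).2)] with z h1 h2
          exact congrArg (fun T : (κ → ℂ) →L[ℂ] ℂ => T (Pi.single i 1))
            (fderiv_add h1.differentiableAt h2.differentiableAt)
      map_smul' := fun c g => by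
        rw [RingHom.id_apply, ← map_smul]
        refine (mk_partialFun_congr i (G := c • Function.surjInv mk_surjective g) ?_).trans ?_
        · rw [map_smul]
          simp only [Function.surjInv_eq mk_surjective]
        · rw [mk_eq_mk]
          filter_upwards [(AnalyticAt.eventually_analyticAt (Function.surjInv mk_surjective g).2)]
            with z h1
          exact congrArg (fun T : (κ → ℂ) →L[ℂ] ℂ => T (Pi.single i 1))
            (fderiv_const_smul h1.differentiableAt c) }
    fun g h => by
      have e : mk (partialFun i (Function.surjInv mk_surjective g *
            Function.surjInv mk_surjective h)) =
          mk (Function.surjInv mk_surjective g * partialFun i (Function.surjInv mk_surjective h) +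
            Function.surjInv mk_surjective h * partialFun i (Function.surjInv mk_surjective g)) := by
        rw [mk_eq_mk]
        filter_upwards [(AnalyticAt.eventually_analyticAt (Function.surjInv mk_surjective g).2),
          (AnalyticAt.eventually_analyticAt (Function.surjInv mk_surjective h).2)] with z h1 h2
        exact congrArg (fun T : (κ → ℂ) →L[ℂ] ℂ => T (Pi.single i 1))
          (fderiv_mul h1.differentiableAt h2.differentiableAt)
      refine (mk_partialFun_congr i (G := Function.surjInv mk_surjective g *
        Function.surjInv mk_surjective h) ?_).trans (e.trans ?_)
      · rw [map_mul]
        simp only [Function.surjInv_eq mk_surjective]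
      · rw [map_add, map_mul, map_mul]
        simp only [Function.surjInv_eq mk_surjective]
        rfl

theorem pderiv_mk (i : κ) (F : analyticFunctions κ) : pderiv i (mk F) = mk (partialFun i F) :=
  mk_partialFun_congr i (Function.surjInv_eq mk_surjective _)

theorem pderiv_coord (i j : κ) : pderiv i (coord j) = if i = j then 1 else 0 := by
  rw [coord, pderiv_mk]
  have : partialFun i ⟨fun z => z j,
      (ContinuousLinearMap.proj (R := ℂ) (φ := fun _ : κ => ℂ) j).analyticAt 0⟩ =
      if i = j then 1 else 0 := by
    refine Subtype.ext (funext fun z => ?_)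
    have h : fderiv ℂ (fun z : κ → ℂ => z j) z = ContinuousLinearMap.proj j :=
      (ContinuousLinearMap.proj (R := ℂ) (φ := fun _ : κ => ℂ) j).fderiv
    change fderiv ℂ (fun z : κ → ℂ => z j) z (Pi.single i 1) = _
    rw [h, ContinuousLinearMap.proj_apply]
    by_cases hij : i = j
    · subst hij
      simp
    · simp [hij, Ne.symm hij]
  rw [this]
  split_ifs <;> simp

end LocalRing
end Local

/-! ### Derivations of germs, and fundamental solutions in coordinates. -/

section Local

variable {κ : Type} [Fintype κ]

namespace LocalRing

/-- The order of vanishing at the origin along the line spanned by `z`. -/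
def rayOrder (z : κ → ℂ) (g : LocalRing κ) : ℕ∞ :=
  analyticOrderAt (fun t : ℂ => (Function.surjInv mk_surjective g).1 (t • z)) 0

theorem tendsto_smul_zero {ι : Type*} (z : ι → ℂ) : Tendsto (fun t : ℂ => t • z) (𝓝 0) (𝓝 0) := by
  have : Continuous fun t : ℂ => t • z := by fun_prop
  simpa using this.tendsto 0

theorem rayOrder_mk (z : κ → ℂ) (F : analyticFunctions κ) :
    rayOrder z (mk F) = analyticOrderAt (fun t : ℂ => F.1 (t • z)) 0 :=
  analyticOrderAt_congr
    ((tendsto_smul_zero z).eventually (mk_eq_mk.mp (Function.surjInv_eq mk_surjective (mk F))))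

theorem analyticAt_comp_smul (z : κ → ℂ) (F : analyticFunctions κ) :
    AnalyticAt ℂ (fun t : ℂ => F.1 (t • z)) 0 := by
  have h : AnalyticAt ℂ (fun t : ℂ => t • z) 0 :=
    ((ContinuousLinearMap.id ℂ ℂ).smulRight z).analyticAt 0
  have hF : AnalyticAt ℂ F.1 0 := F.2
  exact hF.comp_of_eq h (by simp)

theorem le_rayOrder_add (z : κ → ℂ) (g h : LocalRing κ) :
    min (rayOrder z g) (rayOrder z h) ≤ rayOrder z (g + h) := by
  obtain ⟨F, rfl⟩ := mk_surjective g
  obtain ⟨G, rfl⟩ := mk_surjective h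
  rw [← map_add, rayOrder_mk, rayOrder_mk, rayOrder_mk]
  exact le_analyticOrderAt_add

theorem le_rayOrder_sum (z : κ → ℂ) {ι : Type*} (s : Finset ι) (g : ι → LocalRing κ) (n : ℕ∞)
    (h : ∀ i ∈ s, n ≤ rayOrder z (g i)) : n ≤ rayOrder z (∑ i ∈ s, g i) := by
  classical
  induction s using Finset.induction_on with
  | empty =>
    rw [Finset.sum_empty, ← map_zero mk, rayOrder_mk]
    refine le_top.trans_eq (Eq.symm ?_)
    rw [analyticOrderAt_eq_top]
    exact Eventually.of_forall fun _ => rfl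
  | insert i s hi ih =>
    rw [Finset.sum_insert hi]
    exact (le_min (h i (Finset.mem_insert_self i s))
      (ih fun j hj => h j (Finset.mem_insert_of_mem hj))).trans (le_rayOrder_add z _ _)

theorem rayOrder_mul (z : κ → ℂ) (g h : LocalRing κ) :
    rayOrder z (g * h) = rayOrder z g + rayOrder z h := by
  obtain ⟨F, rfl⟩ := mk_surjective g
  obtain ⟨G, rfl⟩ := mk_surjective h
  rw [← map_mul, rayOrder_mk, rayOrder_mk, rayOrder_mk]
  exact analyticOrderAt_mul (analyticAt_comp_smul z F) (analyticAt_comp_smul z G)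

theorem one_le_rayOrder_coord (z : κ → ℂ) (i : κ) : 1 ≤ rayOrder z (coord i) := by
  rw [Order.one_le_iff_pos, pos_iff_ne_zero, coord, rayOrder_mk, analyticOrderAt_ne_zero]
  exact ⟨analyticAt_comp_smul z _, by simp⟩

/-- A separation statement: infinite order along every line through the origin forces the germ to
vanish. -/
theorem eq_zero_of_rayOrder {g : LocalRing κ} (h : ∀ z, ∀ n : ℕ, n ≤ rayOrder z g) : g = 0 := by
  obtain ⟨F, rfl⟩ := mk_surjective g
  rw [mk_eq_zero]
  refine eventually_eq_zero_of_order F.2 fun z => ?_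
  rw [← analyticOrderAt_eq_top, ← rayOrder_mk]
  exact ENat.eq_top_iff_forall_ge.mpr (h z)

/-- Hadamard's lemma. -/
theorem exists_eq_add_sum_coord_mul (g : LocalRing κ) :
    ∃ (c : ℂ) (h : κ → LocalRing κ), g = algebraMap ℂ _ c + ∑ i, coord i * h i := by
  classical
  obtain ⟨F, rfl⟩ := mk_surjective g
  obtain ⟨G, hG, hFG⟩ := exists_analyticAt_hadamard (F := F.1) F.2
  let H : κ → analyticFunctions κ := fun i =>
    ⟨fun z => G z (Pi.single i 1), analyticAt_clm_apply hG analyticAt_const⟩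
  let Z : κ → analyticFunctions κ := fun i =>
    ⟨fun z => z i, (ContinuousLinearMap.proj (R := ℂ) (φ := fun _ : κ => ℂ) i).analyticAt 0⟩
  refine ⟨F.1 0, fun i => mk (H i), ?_⟩
  have : algebraMap ℂ (LocalRing κ) (F.1 0) + ∑ i, coord i * mk (H i) =
      mk (algebraMap ℂ _ (F.1 0) + ∑ i, Z i * H i) := by
    rw [map_add, map_sum, AlgHom.commutes]
    simp only [map_mul]
    rfl
  rw [this, mk_eq_mk]
  filter_upwards [hFG] with z hz
  have e1 : (algebraMap ℂ (analyticFunctions κ) (F.1 0) + ∑ i, Z i * H i).1 z =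
      F.1 0 + ∑ i, z i * G z (Pi.single i 1) := by
    simp [Z, H]
  rw [e1, hz]
  congr 1
  have h2 : G z z = G z (∑ i, z i • Pi.single i 1) := congrArg (G z) (pi_eq_sum_univ' z)
  rw [h2, map_sum]
  simp

/-- No continuity of V is available, so polynomials alone do not suffice. By Hadamard's lemma g = c
+ Σ xᵢhᵢ, whence V g = Σ xᵢ V(hᵢ): the order of every value of V exceeds by one any bound valid for
all values, and is therefore infinite. -/
theorem derivation_eq_zero {V : Derivation ℂ (LocalRing κ) (LocalRing κ)}
    (h : ∀ i, V (coord i) = 0) : V = 0 := by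
  have key : ∀ n : ℕ, ∀ z g, (n : ℕ∞) ≤ rayOrder z (V g) := by
    intro n
    induction n with
    | zero => simp
    | succ n ih =>
      intro z g
      obtain ⟨c, k, rfl⟩ := exists_eq_add_sum_coord_mul g
      simp only [map_add, map_sum, V.map_algebraMap, zero_add, V.leibniz, h, smul_eq_mul]
      refine le_rayOrder_sum z _ _ _ fun i _ => ?_
      rw [mul_zero, add_zero, rayOrder_mul, Nat.cast_succ, add_comm]
      exact add_le_add (one_le_rayOrder_coord z i) (ih z _)
  ext1 g
  exact eq_zero_of_rayOrder fun z n => key n z g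

/-- A polynomial vanishing near the origin vanishes identically. This is used later to show that no
nonzero rational function has zero germ. -/
theorem algebraicIndependent_coord : AlgebraicIndependent ℂ (coord (κ := κ)) := by
  rw [algebraicIndependent_iff]
  intro q hq
  let Z : κ → analyticFunctions κ := fun i =>
    ⟨fun z => z i, (ContinuousLinearMap.proj (R := ℂ) (φ := fun _ : κ => ℂ) i).analyticAt 0⟩
  have e1 : MvPolynomial.aeval (coord (κ := κ)) q = mk (MvPolynomial.aeval Z q) :=
    (MvPolynomial.comp_aeval_apply Z mk q).symm
  have e2 : ∀ z, (MvPolynomial.aeval Z q).1 z = MvPolynomial.eval z q := by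
    intro z
    have := MvPolynomial.comp_aeval_apply Z
      ((Pi.evalAlgHom ℂ (fun _ : κ → ℂ => ℂ) z).comp (analyticFunctions κ).val) q
    refine this.trans ?_
    rw [MvPolynomial.aeval_eq_eval]
    rfl
  rw [e1, mk_eq_zero] at hq
  simp only [e2] at hq
  have han : AnalyticOnNhd ℂ (fun z : κ → ℂ => MvPolynomial.eval z q) Set.univ :=
    AnalyticOnNhd.eval_mvPolynomial q
  refine MvPolynomial.funext fun z => ?_
  rw [map_zero]
  exact han.eqOn_zero_of_preconnected_of_eventuallyEq_zero isPreconnected_univ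
    (Set.mem_univ 0) hq (Set.mem_univ z)

/-- The connection form with coefficients `f`. -/
def connectionForm {M : Type*} [NormedRing M] [NormedAlgebra ℂ M] (f : κ → (κ → ℂ) → M)
    (z : κ → ℂ) : (κ → ℂ) →L[ℂ] M :=
  ∑ i, ContinuousLinearMap.smulRightL ℂ (κ → ℂ) M (ContinuousLinearMap.proj i) (f i z)

theorem connectionForm_apply {M : Type*} [NormedRing M] [NormedAlgebra ℂ M]
    (f : κ → (κ → ℂ) → M) (z v : κ → ℂ) : connectionForm f z v = ∑ i, v i • f i z := by
  simp [connectionForm]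

/-- The Frobenius theorem for linear systems, in coordinates. -/
theorem exists_analyticAt_parallel_coord [DecidableEq κ] {M : Type*} [NormedRing M]
    [NormedAlgebra ℂ M] [CompleteSpace M] {f : κ → (κ → ℂ) → M} (hf : ∀ i, AnalyticAt ℂ (f i) 0)
    (hflat : ∀ i j, ∀ᶠ z in 𝓝 (0 : κ → ℂ), fderiv ℂ (f j) z (Pi.single i 1) -
      fderiv ℂ (f i) z (Pi.single j 1) + (f i z * f j z - f j z * f i z) = 0) :
    ∃ u : (κ → ℂ) → M, AnalyticAt ℂ u 0 ∧ u 0 = 1 ∧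
      ∀ i, ∀ᶠ z in 𝓝 (0 : κ → ℂ), fderiv ℂ u z (Pi.single i 1) = -(f i z * u z) := by
  have hΓ : AnalyticAt ℂ (connectionForm f) 0 :=
    Finset.analyticAt_fun_sum _ fun i _ =>
      ((ContinuousLinearMap.smulRightL ℂ (κ → ℂ) M (ContinuousLinearMap.proj i)).analyticAt _).comp
        (hf i)
  have hd : ∀ z, (∀ i, AnalyticAt ℂ (f i) z) → ∀ v w,
      fderiv ℂ (connectionForm f) z v w = ∑ i, w i • fderiv ℂ (f i) z v := by
    intro z hz v w
    have : HasFDerivAt (connectionForm f) (∑ i,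
        (ContinuousLinearMap.smulRightL ℂ (κ → ℂ) M (ContinuousLinearMap.proj i)).comp
          (fderiv ℂ (f i) z)) z :=
      HasFDerivAt.fun_sum fun i _ =>
        (ContinuousLinearMap.smulRightL ℂ (κ → ℂ) M (ContinuousLinearMap.proj i)).hasFDerivAt.comp z
          (hz i).differentiableAt.hasFDerivAt
    rw [this.fderiv]
    simp
  have hexp : ∀ i z v, fderiv ℂ (f i) z v = ∑ j, v j • fderiv ℂ (f i) z (Pi.single j 1) := by
    intro i z v
    conv_lhs => rw [pi_eq_sum_univ' v]
    simp
  have hflat' : ∀ᶠ z in 𝓝 (0 : κ → ℂ), ∀ v w,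
      fderiv ℂ (connectionForm f) z v w - fderiv ℂ (connectionForm f) z w v +
        (connectionForm f z v * connectionForm f z w -
          connectionForm f z w * connectionForm f z v) = 0 := by
    filter_upwards [eventually_all.mpr fun i => eventually_all.mpr fun j => hflat i j,
      eventually_all.mpr fun i => (hf i).eventually_analyticAt] with z h1 h2 v w
    rw [hd z h2, hd z h2]
    have e1 : ∑ i, w i • fderiv ℂ (f i) z v =
        ∑ i, ∑ j, (v i * w j) • fderiv ℂ (f j) z (Pi.single i 1) := by
      rw [Finset.sum_comm]
      refine Finset.sum_congr rfl fun i _ => ?_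
      rw [hexp, Finset.smul_sum]
      exact Finset.sum_congr rfl fun j _ => by rw [smul_smul, mul_comm]
    have e2 : ∑ i, v i • fderiv ℂ (f i) z w =
        ∑ i, ∑ j, (v i * w j) • fderiv ℂ (f i) z (Pi.single j 1) := by
      refine Finset.sum_congr rfl fun i _ => ?_
      rw [hexp, Finset.smul_sum]
      exact Finset.sum_congr rfl fun j _ => by rw [smul_smul]
    have e3 : connectionForm f z v * connectionForm f z w =
        ∑ i, ∑ j, (v i * w j) • (f i z * f j z) := by
      rw [connectionForm_apply, connectionForm_apply, Finset.sum_mul_sum]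
      simp only [smul_mul_smul_comm]
    have e4 : connectionForm f z w * connectionForm f z v =
        ∑ i, ∑ j, (v i * w j) • (f j z * f i z) := by
      rw [connectionForm_apply, connectionForm_apply, Finset.sum_mul_sum, Finset.sum_comm]
      simp only [smul_mul_smul_comm, mul_comm (w _)]
    rw [e1, e2, e3, e4]
    simp only [← Finset.sum_sub_distrib, ← Finset.sum_add_distrib, ← smul_sub, ← smul_add, h1,
      smul_zero, Finset.sum_const_zero]
  obtain ⟨u, hu, hu0, h⟩ := exists_analyticAt_parallel hΓ hflat'
  refine ⟨u, hu, hu0, fun i => ?_⟩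
  filter_upwards [h (Pi.single i 1)] with z hz
  rw [hz, connectionForm_apply]
  simp [Pi.single_apply]

/-- The algebra of matrices, with the norm of operators on `ℂ^κ`. -/
def matrixEquiv (κ : Type) [Fintype κ] [DecidableEq κ] : Matrix κ κ ℂ ≃ₐ[ℂ] Op (κ → ℂ) :=
  Matrix.toLinAlgEquiv'.trans (Module.End.toContinuousLinearMap (κ → ℂ))

/-- The linear form taking an operator to an entry of its matrix. -/
def matrixEntry [DecidableEq κ] (a b : κ) : Op (κ → ℂ) →L[ℂ] ℂ :=
  LinearMap.toContinuousLinearMap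
    { toFun := fun T => (matrixEquiv κ).symm T a b
      map_add' := fun S T => by simp
      map_smul' := fun c T => by simp }

theorem matrixEntry_apply [DecidableEq κ] (a b : κ) (T : Op (κ → ℂ)) :
    matrixEntry a b T = (matrixEquiv κ).symm T a b := rfl

theorem op_ext [DecidableEq κ] {S T : Op (κ → ℂ)}
    (h : ∀ a b, matrixEntry a b S = matrixEntry a b T) : S = T :=
  (matrixEquiv κ).symm.injective (Matrix.ext h)

theorem matrixEntry_mul [DecidableEq κ] (a b : κ) (S T : Op (κ → ℂ)) :
    matrixEntry a b (S * T) = ∑ c, matrixEntry a c S * matrixEntry c b T := by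
  simp only [matrixEntry_apply, map_mul, Matrix.mul_apply]

/-- A flat matrix of analytic connection forms admits a fundamental solution. -/
theorem exists_fundamental_solution [DecidableEq κ] (Γ : κ → Matrix κ κ (LocalRing κ))
    (hflat : ∀ i j a b, pderiv i (Γ j a b) - pderiv j (Γ i a b) +
      (Γ i * Γ j - Γ j * Γ i) a b = 0) :
    ∃ U : Matrix κ κ (LocalRing κ), IsUnit U.det ∧
      ∀ i a b, pderiv i (U a b) = -(Γ i * U) a b := by
  choose F hF using fun i a b => mk_surjective (Γ i a b)
  have hFan : ∀ i a b, AnalyticAt ℂ (F i a b).1 0 := fun i a b => (F i a b).2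
  let f : κ → (κ → ℂ) → Op (κ → ℂ) := fun i z =>
    ∑ a, ∑ b, (F i a b).1 z • matrixEquiv κ (Matrix.single a b 1)
  have hentry : ∀ i z a b, matrixEntry a b (f i z) = (F i a b).1 z := by
    intro i z a b
    have : f i z = matrixEquiv κ (Matrix.of fun a b => (F i a b).1 z) := by
      rw [Matrix.matrix_eq_sum_single (Matrix.of fun a b => (F i a b).1 z)]
      simp only [map_sum, f, ← map_smul, Matrix.smul_single, smul_eq_mul, mul_one, Matrix.of_apply]
    rw [this, matrixEntry_apply, AlgEquiv.symm_apply_apply, Matrix.of_apply]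
  have hfan : ∀ i z, (∀ a b, AnalyticAt ℂ (F i a b).1 z) → AnalyticAt ℂ (f i) z := fun i z hz =>
    Finset.analyticAt_fun_sum _ fun a _ => Finset.analyticAt_fun_sum _ fun b _ =>
      (hz a b).smul analyticAt_const
  have hFd : ∀ i j a b z, (∀ a b, AnalyticAt ℂ (F i a b).1 z) →
      matrixEntry a b (fderiv ℂ (f i) z (Pi.single j 1)) =
        fderiv ℂ (F i a b).1 z (Pi.single j 1) := by
    intro i j a b z hz
    have h1 := (matrixEntry a b).hasFDerivAt.comp z (hfan i z hz).differentiableAt.hasFDerivAt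
    have h2 : matrixEntry a b ∘ f i = (F i a b).1 := funext fun z => hentry i z a b
    rw [h2] at h1
    rw [h1.fderiv]
    rfl
  have hev : ∀ᶠ z in 𝓝 (0 : κ → ℂ), ∀ i a b, AnalyticAt ℂ (F i a b).1 z :=
    eventually_all.mpr fun i => eventually_all.mpr fun a => eventually_all.mpr fun b =>
      (hFan i a b).eventually_analyticAt
  have hflat' : ∀ i j, ∀ᶠ z in 𝓝 (0 : κ → ℂ), fderiv ℂ (f j) z (Pi.single i 1) -
      fderiv ℂ (f i) z (Pi.single j 1) + (f i z * f j z - f j z * f i z) = 0 := by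
    intro i j
    have h1 : ∀ a b, ∀ᶠ z in 𝓝 (0 : κ → ℂ), fderiv ℂ (F j a b).1 z (Pi.single i 1) -
        fderiv ℂ (F i a b).1 z (Pi.single j 1) +
          (∑ c, (F i a c).1 z * (F j c b).1 z - ∑ c, (F j a c).1 z * (F i c b).1 z) = 0 := by
      intro a b
      have h2 := hflat i j a b
      simp only [Matrix.sub_apply, Matrix.mul_apply, ← hF, pderiv_mk, ← map_mul, ← map_sum,
        ← map_sub, ← map_add, mk_eq_zero] at h2
      filter_upwards [h2] with z hz
      simpa [partialFun] using hz
    filter_upwards [hev, eventually_all.mpr fun a => eventually_all.mpr (h1 a)] with z hz h2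
    refine op_ext fun a b => ?_
    simp only [map_add, map_sub, map_zero, matrixEntry_mul, hentry, hFd _ _ _ _ z (hz _)]
    exact h2 a b
  obtain ⟨u, hu, hu0, hu1⟩ := exists_analyticAt_parallel_coord
    (fun i => hfan i 0 (hFan i)) hflat'
  let U : κ → κ → analyticFunctions κ := fun a b =>
    ⟨fun z => matrixEntry a b (u z), ((matrixEntry a b).analyticAt _).comp hu⟩
  refine ⟨Matrix.of fun a b => mk (U a b), ?_, fun i a b => ?_⟩
  -- The solution is normalized by u(0) = 1, so the determinant has value 1 at the origin and is a
  -- unit of the local ring.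
  · refine isUnit_of_value_ne_zero ?_
    rw [RingHom.map_det]
    have : value.mapMatrix (Matrix.of fun a b => mk (U a b)) = 1 := by
      ext a b
      change matrixEntry a b (u 0) = _
      rw [hu0, matrixEntry_apply, map_one]
    rw [this, Matrix.det_one]
    exact one_ne_zero
  · simp only [Matrix.mul_apply, ← hF, Matrix.of_apply, pderiv_mk, ← map_mul,
      ← map_sum, ← map_neg]
    rw [mk_eq_mk]
    filter_upwards [hu1 i, hu.eventually_analyticAt] with z h1 h2
    have h3 := ((matrixEntry a b).hasFDerivAt.comp z h2.differentiableAt.hasFDerivAt).fderiv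
    have h4 : (partialFun i (U a b)).1 z = matrixEntry a b (fderiv ℂ u z (Pi.single i 1)) :=
      congrArg (fun T : (κ → ℂ) →L[ℂ] ℂ => T (Pi.single i 1)) h3
    rw [h4, h1, map_neg, matrixEntry_mul]
    simp [hentry, U]

end LocalRing
end Local

/-! ### Coordinate calculus for connections and horizontal frames. -/

section Coordinates

/-- Conjugation of a derivation by an isomorphism of algebras. -/
def conjDerivation {k R S : Type*} [CommRing k] [CommRing R] [CommRing S] [Algebra k R]
    [Algebra k S] (e : R ≃ₐ[k] S) (V : Derivation k R R) : Derivation k S S :=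
  Derivation.mk' (e.toLinearMap ∘ₗ V.toLinearMap ∘ₗ e.symm.toLinearMap) fun a b => by
    simp [V.leibniz]

theorem conjDerivation_apply {k R S : Type*} [CommRing k] [CommRing R] [CommRing S] [Algebra k R]
    [Algebra k S] (e : R ≃ₐ[k] S) (V : Derivation k R R) (s : S) :
    conjDerivation e V s = e (V (e.symm s)) := rfl

/-- A system of coordinates in an algebra that looks like the ring of germs of analytic functions
at a point of a complex manifold: the partial derivatives with respect to the coordinates exist,
they determine all derivations, and flat linear systems have fundamental solutions. -/
structure AnalyticCoordinates (R κ : Type*) [CommRing R] [Algebra ℂ R] [Fintype κ]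
    [DecidableEq κ] where
  coord : κ → R
  pderiv : κ → Derivation ℂ R R
  pderiv_coord : ∀ i j, pderiv i (coord j) = if i = j then 1 else 0
  derivation_eq_zero : ∀ V : Derivation ℂ R R, (∀ i, V (coord i) = 0) → V = 0
  exists_fundamental_solution : ∀ Γ : κ → Matrix κ κ R,
    (∀ i j a b, pderiv i (Γ j a b) - pderiv j (Γ i a b) + (Γ i * Γ j - Γ j * Γ i) a b = 0) →
      ∃ U : Matrix κ κ R, IsUnit U.det ∧ ∀ i a b, pderiv i (U a b) = -(Γ i * U) a b
  isDomain : IsDomain R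
  algebraicIndependent : AlgebraicIndependent ℂ coord

/-- The coordinates on the ring of germs at the origin of analytic functions. -/
def LocalRing.coordinates (κ : Type) [Fintype κ] [DecidableEq κ] :
    AnalyticCoordinates (LocalRing κ) κ where
  coord := LocalRing.coord
  pderiv := LocalRing.pderiv
  pderiv_coord := LocalRing.pderiv_coord
  derivation_eq_zero _ := LocalRing.derivation_eq_zero
  exists_fundamental_solution := LocalRing.exists_fundamental_solution
  isDomain := inferInstance
  algebraicIndependent := LocalRing.algebraicIndependent_coord

namespace AnalyticCoordinates

variable {R S κ : Type*} [CommRing R] [Algebra ℂ R] [CommRing S] [Algebra ℂ S] [Fintype κ]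
  [DecidableEq κ]

/-- Transport of coordinates along an isomorphism. -/
def map (C : AnalyticCoordinates R κ) (e : R ≃ₐ[ℂ] S) : AnalyticCoordinates S κ where
  coord i := e (C.coord i)
  pderiv i := conjDerivation e (C.pderiv i)
  pderiv_coord i j := by
    rw [conjDerivation_apply, e.symm_apply_apply, C.pderiv_coord]
    split_ifs <;> simp
  derivation_eq_zero V hV := by
    have h := C.derivation_eq_zero (conjDerivation e.symm V) fun i => by
      rw [conjDerivation_apply, AlgEquiv.symm_symm, hV, map_zero]
    ext s
    have := congrArg (fun W : Derivation ℂ R R => e (W (e.symm s))) h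
    simpa [conjDerivation_apply] using this
  exists_fundamental_solution Γ hΓ := by
    obtain ⟨U, hU, h⟩ := C.exists_fundamental_solution (fun i => (Γ i).map e.symm) fun i j a b => by
      have := congrArg e.symm (hΓ i j a b)
      simpa [conjDerivation_apply, Matrix.mul_apply] using this
    refine ⟨U.map e, ?_, fun i a b => ?_⟩
    · have : (U.map e).det = e U.det := (AlgEquiv.map_det e U).symm
      rw [this]
      exact hU.map e
    · have := congrArg e (h i a b)
      simpa [conjDerivation_apply, Matrix.mul_apply] using this
  isDomain := by
    have := C.isDomain
    exact e.symm.toMulEquiv.isDomain R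
  algebraicIndependent :=
    C.algebraicIndependent.map' (f := (e : R →ₐ[ℂ] S)) e.injective

variable (C : AnalyticCoordinates R κ)

theorem derivation_ext {V W : Derivation ℂ R R} (h : ∀ i, V (C.coord i) = W (C.coord i)) :
    V = W := by
  refine sub_eq_zero.mp (C.derivation_eq_zero _ fun i => ?_)
  rw [Derivation.sub_apply, h, sub_self]

theorem sum_smul_pderiv_coord (f : κ → R) (j : κ) :
    (∑ i, f i • C.pderiv i) (C.coord j) = f j := by
  rw [← Derivation.coeFnAddMonoidHom_apply, map_sum, Finset.sum_apply]
  simp [C.pderiv_coord]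

theorem derivation_eq_sum (V : Derivation ℂ R R) : V = ∑ i, V (C.coord i) • C.pderiv i :=
  C.derivation_ext fun j => (C.sum_smul_pderiv_coord (fun i => V (C.coord i)) j).symm

theorem span_pderiv : Submodule.span R (Set.range C.pderiv) = ⊤ := by
  refine eq_top_iff.mpr fun V _ => ?_
  rw [C.derivation_eq_sum V]
  exact Submodule.sum_mem _ fun i _ =>
    Submodule.smul_mem _ _ (Submodule.subset_span (Set.mem_range_self i))

theorem lie_pderiv (i j : κ) : ⁅C.pderiv i, C.pderiv j⁆ = 0 := by
  refine C.derivation_eq_zero _ fun l => ?_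
  rw [Derivation.commutator_apply, C.pderiv_coord, C.pderiv_coord]
  split_ifs <;> simp

theorem isHorizontal_iff (E : Connection ℂ R) (Y : Derivation ℂ R R) :
    E.IsHorizontal Y ↔ ∀ i, E.cov (C.pderiv i) Y = 0 := by
  refine ⟨fun h i => h _, fun h X => ?_⟩
  rw [C.derivation_eq_sum X]
  simp [h]

/-- The Christoffel symbols of a connection. -/
def christoffel (E : Connection ℂ R) (i : κ) : Matrix κ κ R :=
  Matrix.of fun a b => E.cov (C.pderiv i) (C.pderiv b) (C.coord a)

theorem sum_apply {ι : Type*} (s : Finset ι) (V : ι → Derivation ℂ R R) (f : R) :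
    (∑ i ∈ s, V i) f = ∑ i ∈ s, V i f := by
  rw [← Derivation.coeFnAddMonoidHom_apply, map_sum, Finset.sum_apply]
  rfl

theorem cov_sum_coord (E : Connection ℂ R) (i : κ) (u : κ → R) (a : κ) :
    E.cov (C.pderiv i) (∑ b, u b • C.pderiv b) (C.coord a) =
      C.pderiv i (u a) + ∑ b, C.christoffel E i a b * u b := by
  rw [map_sum, sum_apply]
  simp only [E.leibniz, Derivation.add_apply, Derivation.smul_apply, C.pderiv_coord, smul_eq_mul,
    mul_ite, mul_one, mul_zero, Finset.sum_add_distrib]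
  rw [Finset.sum_ite_eq' Finset.univ a, if_pos (Finset.mem_univ a)]
  congr 1
  exact Finset.sum_congr rfl fun b _ => mul_comm _ _

/-- Coordinate fields commute, so the curvature is exactly the integrability expression of the
linear system with matrices Γᵢ. -/
theorem curvature_coord (E : Connection ℂ R) (i j a b : κ) :
    E.curvature (C.pderiv i) (C.pderiv j) (C.pderiv b) (C.coord a) =
      C.pderiv i (C.christoffel E j a b) - C.pderiv j (C.christoffel E i a b) +
        (C.christoffel E i * C.christoffel E j - C.christoffel E j * C.christoffel E i) a b := by
  have h : ∀ i j, E.cov (C.pderiv i) (E.cov (C.pderiv j) (C.pderiv b)) (C.coord a) =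
      C.pderiv i (C.christoffel E j a b) + (C.christoffel E i * C.christoffel E j) a b := by
    intro i j
    rw [C.derivation_eq_sum (E.cov (C.pderiv j) (C.pderiv b)), C.cov_sum_coord]
    rfl
  rw [Connection.curvature, C.lie_pderiv, map_zero, LinearMap.zero_apply, sub_zero,
    Derivation.sub_apply, h, h, Matrix.sub_apply]
  ring

/-- A flat connection has a frame of horizontal vector fields. -/
theorem span_isHorizontal {E : Connection ℂ R}
    (hE : ∀ i j b, E.curvature (C.pderiv i) (C.pderiv j) (C.pderiv b) = 0) :
    Submodule.span R {Y | E.IsHorizontal Y} = ⊤ := by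
  obtain ⟨U, hU, h⟩ := C.exists_fundamental_solution (C.christoffel E) fun i j a b => by
    rw [← C.curvature_coord, hE]
    rfl
  -- The columns of the fundamental matrix are the components of horizontal fields.
  have hY : ∀ b, E.IsHorizontal (∑ a, U a b • C.pderiv a) := by
    intro b
    rw [C.isHorizontal_iff]
    intro i
    refine C.derivation_eq_zero _ fun a => ?_
    rw [C.cov_sum_coord, h, Matrix.mul_apply, neg_add_cancel]
  rw [eq_top_iff, ← C.span_pderiv, Submodule.span_le]
  rintro _ ⟨c, rfl⟩
  -- Since U is invertible over the ring of germs, U⁻¹ writes the coordinate fields in terms of the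
  -- horizontal ones.
  have hc : C.pderiv c = ∑ b, U⁻¹ b c • ∑ a, U a b • C.pderiv a := by
    refine C.derivation_ext fun j => ?_
    rw [sum_apply]
    simp only [Derivation.smul_apply, C.sum_smul_pderiv_coord, C.pderiv_coord, smul_eq_mul]
    have := congrFun (congrFun (Matrix.mul_nonsing_inv U hU) j) c
    rw [Matrix.mul_apply, Matrix.one_apply] at this
    rw [if_congr eq_comm rfl rfl, ← this]
    exact Finset.sum_congr rfl fun b _ => mul_comm _ _
  rw [hc]
  exact Submodule.sum_mem _ fun b _ => Submodule.smul_mem _ _ (Submodule.subset_span (hY b))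

/-- The connection with given Christoffel symbols. -/
def connection (Γ : κ → Matrix κ κ R) : Connection ℂ R where
  cov := LinearMap.mk₂' R ℂ
    (fun X Y => ∑ a, (X (Y (C.coord a)) + ∑ i, ∑ b, X (C.coord i) * (Y (C.coord b) * Γ i a b)) •
      C.pderiv a)
    (fun X X' Y => by
      simp only [Derivation.add_apply, ← Finset.sum_add_distrib, add_mul, ← add_smul]
      refine Finset.sum_congr rfl fun a _ => ?_
      simp only [Finset.sum_add_distrib]
      congr 1
      ring)
    (fun f X Y => by
      simp only [Derivation.smul_apply, Finset.smul_sum, smul_smul, smul_eq_mul, mul_add,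
        Finset.mul_sum, mul_assoc])
    (fun X Y Y' => by
      simp only [Derivation.add_apply, ← Finset.sum_add_distrib, mul_add, add_mul, ← add_smul,
        map_add]
      refine Finset.sum_congr rfl fun a _ => ?_
      simp only [Finset.sum_add_distrib]
      congr 1
      ring)
    (fun c X Y => by
      simp only [Derivation.smul_apply, Finset.smul_sum, X.map_smul, smul_mul_assoc, mul_smul_comm,
        smul_add, ← smul_assoc])
  leibniz X Y f := by
    refine C.derivation_ext fun j => ?_
    simp only [LinearMap.mk₂'_apply, Derivation.add_apply, Derivation.smul_apply,
      C.sum_smul_pderiv_coord, smul_eq_mul, Derivation.leibniz, mul_add, Finset.mul_sum]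
    have : ∀ i b, X (C.coord i) * (f * Y (C.coord b) * Γ i j b) =
        f * (X (C.coord i) * (Y (C.coord b) * Γ i j b)) := fun i b => by ring
    simp only [this]
    ring

theorem connection_coord (Γ : κ → Matrix κ κ R) (X Y : Derivation ℂ R R) (a : κ) :
    (C.connection Γ).cov X Y (C.coord a) =
      X (Y (C.coord a)) + ∑ i, ∑ b, X (C.coord i) * (Y (C.coord b) * Γ i a b) :=
  C.sum_smul_pderiv_coord (fun a => X (Y (C.coord a)) +
    ∑ i, ∑ b, X (C.coord i) * (Y (C.coord b) * Γ i a b)) a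

end AnalyticCoordinates

end Coordinates

/-! ### Implicit parametrization from a submersive presentation. -/

section Chart

theorem hasFDerivAt_eval {ι : Type*} [Fintype ι] (q : MvPolynomial ι ℂ) (z : ι → ℂ) :
    HasFDerivAt (fun z => MvPolynomial.eval z q)
      (∑ i, MvPolynomial.eval z (MvPolynomial.pderiv i q) •
        ContinuousLinearMap.proj (R := ℂ) (φ := fun _ : ι => ℂ) i) z := by
  classical
  induction q using MvPolynomial.induction_on with
  | C a =>
    refine (hasFDerivAt_const a z).congr_fderiv ?_ |>.congr_of_eventuallyEq ?_
    · ext v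
      simp
    · exact Eventually.of_forall fun z => by simp
  | add p q hp hq =>
    refine (hp.add hq).congr_fderiv ?_ |>.congr_of_eventuallyEq ?_
    · ext v
      simp [add_mul, Finset.sum_add_distrib]
    · exact Eventually.of_forall fun z => by simp
  | mul_X p j hp =>
    have hj : HasFDerivAt (fun z : ι → ℂ => z j)
        (ContinuousLinearMap.proj (R := ℂ) (φ := fun _ : ι => ℂ) j) z :=
      (ContinuousLinearMap.proj (R := ℂ) (φ := fun _ : ι => ℂ) j).hasFDerivAt
    refine (hp.mul hj).congr_fderiv ?_ |>.congr_of_eventuallyEq ?_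
    · ext v
      simp [MvPolynomial.pderiv_X, Pi.single_apply, Finset.sum_add_distrib, add_mul,
        Finset.mul_sum, apply_ite (MvPolynomial.eval z), mul_assoc]
    · exact Eventually.of_forall fun z => by simp

variable {S : Type*} {ι σ : Type} [CommRing S] [Algebra ℂ S] [Fintype ι] [Fintype σ]

/-- The indices outside the range of `P.map` are the free variables. The inverse function theorem
applies to Φ = (centred free variables, relations), whose differential is invertible because the
Jacobian is a unit of S; then ψ(w) = Φ⁻¹(w, 0). The last clause says that ψ catches every solution
of the relations near the base point. -/
theorem exists_implicit_parametrization (P : Algebra.SubmersivePresentation ℂ S ι σ)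
    (φ : S →ₐ[ℂ] ℂ) [Fintype ((Set.range P.map)ᶜ : Set ι)] :
    ∃ ψ : (((Set.range P.map)ᶜ : Set ι) → ℂ) → (ι → ℂ), AnalyticAt ℂ ψ 0 ∧
      (ψ 0 = fun i => φ (P.val i)) ∧
      (∀ᶠ w in 𝓝 0, (∀ k : ((Set.range P.map)ᶜ : Set ι), ψ w k - φ (P.val k) = w k) ∧
        ∀ r, MvPolynomial.eval (ψ w) (P.relation r) = 0) ∧
      ∀ᶠ z in 𝓝 (fun i => φ (P.val i)), (∀ r, MvPolynomial.eval z (P.relation r) = 0) →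
        z = ψ (fun k => z k - φ (P.val k)) := by
  classical
  set z₀ : ι → ℂ := fun i => φ (P.val i) with hz₀
  let Φ : (ι → ℂ) → (((Set.range P.map)ᶜ : Set ι) → ℂ) × (σ → ℂ) := fun z =>
    (fun k => z k - z₀ k, fun r => MvPolynomial.eval z (P.relation r))
  have heval : ∀ q : MvPolynomial ι ℂ, MvPolynomial.eval z₀ q = φ (MvPolynomial.aeval P.val q) := by
    intro q
    rw [← AlgHom.comp_apply, MvPolynomial.comp_aeval, MvPolynomial.aeval_eq_eval]
  have hΦ0 : Φ z₀ = 0 := by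
    refine Prod.ext (funext fun k => sub_self _) (funext fun r => ?_)
    change MvPolynomial.eval z₀ (P.relation r) = 0
    rw [heval, P.aeval_val_relation, map_zero]
  have hΦan : AnalyticAt ℂ Φ z₀ := by
    refine AnalyticAt.prod (AnalyticAt.pi fun k => ?_) (AnalyticAt.pi fun r => ?_)
    · exact ((ContinuousLinearMap.proj (R := ℂ) (φ := fun _ : ι => ℂ) k.1).analyticAt _).sub
        analyticAt_const
    · exact AnalyticOnNhd.eval_mvPolynomial (P.relation r) z₀ (Set.mem_univ _)
  let L : (ι → ℂ) →L[ℂ] (((Set.range P.map)ᶜ : Set ι) → ℂ) × (σ → ℂ) :=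
    (ContinuousLinearMap.pi fun k : ((Set.range P.map)ᶜ : Set ι) =>
      ContinuousLinearMap.proj k.1).prod
    (ContinuousLinearMap.pi fun r => ∑ i, MvPolynomial.eval z₀ (MvPolynomial.pderiv i
      (P.relation r)) • ContinuousLinearMap.proj i)
  have hL : HasFDerivAt Φ L z₀ := by
    refine HasFDerivAt.prodMk (hasFDerivAt_pi.mpr fun k => ?_)
      (hasFDerivAt_pi.mpr fun r => hasFDerivAt_eval _ _)
    exact ((ContinuousLinearMap.proj (R := ℂ) (φ := fun _ : ι => ℂ) k.1).hasFDerivAt).sub_const _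
  have hLinj : Function.Injective L := by
    rw [injective_iff_map_eq_zero]
    intro h hh
    have h1 : ∀ i ∉ Set.range P.map, h i = 0 := fun i hi =>
      congrFun (congrArg Prod.fst hh) ⟨i, hi⟩
    have h2 : ∀ r, ∑ i, MvPolynomial.eval z₀ (MvPolynomial.pderiv i (P.relation r)) * h i = 0 := by
      intro r
      have := congrFun (congrArg Prod.snd hh) r
      simpa [L] using this
    let J : Matrix σ σ ℂ := P.jacobiMatrix.map (MvPolynomial.eval z₀)
    have hJ : IsUnit J.det := by
      have h3 : J.det = φ P.jacobian := by
        rw [P.jacobian_eq_jacobiMatrix_det, P.algebraMap_eq]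
        have : J.det = MvPolynomial.eval z₀ P.jacobiMatrix.det :=
          (RingHom.map_det (MvPolynomial.eval z₀) P.jacobiMatrix).symm
        rw [this, heval]
        rfl
      rw [h3]
      exact P.jacobian_isUnit.map φ
    -- A kernel vector has no free components, so the linearized relations reduce to the square
    -- Jacobian system in the remaining ones.
    have h4 : Matrix.vecMul (fun s => h (P.map s)) J = 0 := by
      ext r
      rw [Pi.zero_apply, ← h2 r, Matrix.vecMul, dotProduct]
      have h5 : ∑ s, MvPolynomial.eval z₀ (MvPolynomial.pderiv (P.map s) (P.relation r)) *
          h (P.map s) = ∑ i, MvPolynomial.eval z₀ (MvPolynomial.pderiv i (P.relation r)) * h i := by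
        refine Finset.sum_of_injOn P.map P.map_inj.injOn (by simp) (fun i _ hi => ?_) (by simp)
        rw [h1 i (by simpa using hi), mul_zero]
      rw [← h5]
      refine Finset.sum_congr rfl fun s _ => ?_
      change h (P.map s) * MvPolynomial.eval z₀ (P.jacobiMatrix s r) = _
      rw [P.jacobiMatrix_apply, mul_comm]
    have h6 : (fun s => h (P.map s)) = 0 :=
      Matrix.vecMul_injective_of_isUnit ((Matrix.isUnit_iff_isUnit_det J).mpr hJ)
        (h4.trans (Matrix.zero_vecMul J).symm)
    ext i
    by_cases hi : i ∈ Set.range P.map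
    · obtain ⟨s, rfl⟩ := hi
      exact congrFun h6 s
    · exact h1 i hi
  have hdim : Module.finrank ℂ (ι → ℂ) =
      Module.finrank ℂ ((((Set.range P.map)ᶜ : Set ι) → ℂ) × (σ → ℂ)) := by
    rw [Module.finrank_prod, Module.finrank_fintype_fun_eq_card,
      Module.finrank_fintype_fun_eq_card, Module.finrank_fintype_fun_eq_card,
      Fintype.card_compl_set, Set.card_range_of_injective P.map_inj]
    have := Fintype.card_le_of_injective P.map P.map_inj
    omega
  let L' : (ι → ℂ) ≃L[ℂ] (((Set.range P.map)ᶜ : Set ι) → ℂ) × (σ → ℂ) :=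
    (LinearEquiv.ofInjectiveOfFinrankEq L.toLinearMap hLinj hdim).toContinuousLinearEquiv
  have hL' : (L' : (ι → ℂ) →L[ℂ] _) = L := by
    ext1 v
    rfl
  have hstrict : HasStrictFDerivAt Φ (L' : (ι → ℂ) →L[ℂ] _) z₀ := by
    rw [hL', ← hL.fderiv]
    exact hΦan.hasStrictFDerivAt
  let e := hstrict.toOpenPartialHomeomorph Φ
  have he : ∀ z, e z = Φ z := fun z => rfl
  have hsrc : z₀ ∈ e.source := hstrict.mem_toOpenPartialHomeomorph_source
  have htgt : (0 : (((Set.range P.map)ᶜ : Set ι) → ℂ) × (σ → ℂ)) ∈ e.target := by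
    rw [← hΦ0]
    exact e.map_source hsrc
  have hsymm0 : e.symm 0 = z₀ := by
    rw [← hΦ0]
    exact e.left_inv hsrc
  have hsymm : AnalyticAt ℂ e.symm 0 := by
    have := e.analyticAt_symm' (i := L') hsrc hΦan (by rw [hL']; exact hL.fderiv)
    rwa [he, hΦ0] at this
  have hinl : AnalyticAt ℂ (fun w : ((Set.range P.map)ᶜ : Set ι) → ℂ => (w, (0 : σ → ℂ))) 0 :=
    analyticAt_id.prod analyticAt_const
  refine ⟨fun w => e.symm (w, 0), hsymm.comp_of_eq hinl rfl, hsymm0, ?_, ?_⟩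
  · have : ∀ᶠ w in 𝓝 (0 : ((Set.range P.map)ᶜ : Set ι) → ℂ), (w, (0 : σ → ℂ)) ∈ e.target :=
      hinl.continuousAt.eventually (e.open_target.mem_nhds htgt)
    filter_upwards [this] with w hw
    have h1 : Φ (e.symm (w, 0)) = (w, 0) := e.right_inv hw
    exact ⟨fun k => congrFun (congrArg Prod.fst h1) k, fun r => congrFun (congrArg Prod.snd h1) r⟩
  · filter_upwards [e.open_source.mem_nhds hsrc] with z hz hr
    have h1 : Φ z = (fun k : ((Set.range P.map)ᶜ : Set ι) => z k - z₀ k, 0) := by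
      refine Prod.ext rfl ?_
      exact funext fun r => hr r
    have h2 := e.left_inv hz
    rw [he, h1] at h2
    exact h2.symm

end Chart

/-! ### Analytic germs on the variety identified with germs on affine space. -/

section Chart

variable {A : Type*} [CommRing A] [Algebra ℂ A]

theorem continuous_eval (a : A) : Continuous fun y : Point A => y.eval a :=
  (continuous_apply a).comp continuous_induced_dom

theorem tendsto_nhds_point {α : Type*} {l : Filter α} {g : α → Point A} {x : Point A}
    (h : ∀ a, Tendsto (fun w => (g w).eval a) l (𝓝 (x.eval a))) : Tendsto g l (𝓝 x) := by
  rw [nhds_induced, tendsto_comap_iff, tendsto_pi_nhds]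
  exact h

theorem mem_analyticGerm {α : Type*} [Fintype α] {x : Point A} (a : α → A) {F : (α → ℂ) → ℂ}
    (hF : AnalyticAt ℂ F fun i => x.eval (a i)) :
    ((fun y : Point A => F fun i => y.eval (a i) : Point A → ℂ) : Germ (𝓝 x) ℂ) ∈
      AnalyticGerm x := by
  let e := Fintype.equivFin α
  refine ⟨Fintype.card α, fun j => a (e.symm j), fun z => F fun i => z (e i), ?_, ?_⟩
  · refine AnalyticAt.fun_comp (g := F) (f := fun (z : Fin (Fintype.card α) → ℂ) i => z (e i))
      (by simpa using hF) ?_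
    exact AnalyticAt.pi fun i => (ContinuousLinearMap.proj (R := ℂ)
      (φ := fun _ : Fin (Fintype.card α) => ℂ) (e i)).analyticAt _
  · simp only [Equiv.symm_apply_apply]

theorem isUnit_regularGerm {x : Point A} {f : A} (hf : x.eval f ≠ 0) : IsUnit (regularGerm x f) := by
  have hinv : AnalyticAt ℂ (fun z : Fin 1 → ℂ => (z 0)⁻¹) fun _ => x.eval f :=
    ((ContinuousLinearMap.proj (R := ℂ) (φ := fun _ : Fin 1 => ℂ) 0).analyticAt _).inv hf
  refine IsUnit.of_mul_eq_one ⟨_, mem_analyticGerm (fun _ : Fin 1 => f) hinv⟩ ?_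
  refine Subtype.ext (Germ.coe_eq.mpr ?_)
  filter_upwards [(continuous_eval f).continuousAt.eventually_ne hf] with y hy
  exact mul_inv_cancel₀ hy

variable {S : Type*} [CommRing S] [Algebra ℂ S] [Algebra A S] [IsScalarTower ℂ A S]
  (f : A) [IsLocalization.Away f S]

variable (S) in
/-- The extension of a point to a principal localization. -/
def extendPoint (y : Point A) (hy : y.eval f ≠ 0) : S →ₐ[ℂ] ℂ :=
  IsLocalization.liftAlgHom (M := Submonoid.powers f) (f := y.eval) fun m => by
    obtain ⟨n, hn⟩ := m.2
    rw [← hn, map_pow]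
    exact (pow_ne_zero n hy).isUnit

variable {f} in
theorem extendPoint_algebraMap {y : Point A} (hy : y.eval f ≠ 0) (a : A) :
    extendPoint S f y hy (algebraMap A S a) = y.eval a :=
  IsLocalization.lift_eq _ _

variable (S) in
/-- The expansion at a point of the elements of a principal localization. -/
def localizedGerm (x : Point A) (hx : x.eval f ≠ 0) : S →ₐ[ℂ] AnalyticGerm x :=
  IsLocalization.liftAlgHom (M := Submonoid.powers f) (f := regularGermHom x) fun m => by
    obtain ⟨n, hn⟩ := m.2
    rw [← hn, map_pow]
    exact (isUnit_regularGerm hx).pow n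

variable {f} in
theorem localizedGerm_algebraMap {x : Point A} (hx : x.eval f ≠ 0) (a : A) :
    localizedGerm S f x hx (algebraMap A S a) = regularGerm x a :=
  IsLocalization.lift_eq _ _

open Classical in
variable (S) in
/-- The value of an element of a principal localization, extended arbitrarily outside the
corresponding open set. -/
def extendEval (x : Point A) (hx : x.eval f ≠ 0) (y : Point A) : S →ₐ[ℂ] ℂ :=
  if hy : y.eval f ≠ 0 then extendPoint S f y hy else extendPoint S f x hx

variable {f} {x : Point A} (hx : x.eval f ≠ 0)

theorem extendEval_algebraMap {y : Point A} (hy : y.eval f ≠ 0) (a : A) :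
    extendEval S f x hx y (algebraMap A S a) = y.eval a := by
  rw [extendEval, dif_pos hy, extendPoint_algebraMap]

theorem extendEval_eq {y : Point A} {φ : S →ₐ[ℂ] ℂ} (hφ : ∀ a, φ (algebraMap A S a) = y.eval a) :
    extendEval S f x hx y = φ := by
  have hf : y.eval f ≠ 0 := by
    rw [← hφ]
    exact ((IsLocalization.Away.algebraMap_isUnit f).map φ).ne_zero
  have : (extendEval S f x hx y : S →+* ℂ) = φ := by
    refine IsLocalization.ringHom_ext (Submonoid.powers f) (RingHom.ext fun a => ?_)
    exact (extendEval_algebraMap hx hf a).trans (hφ a).symm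
  exact AlgHom.ext fun s => congrArg (fun g : S →+* ℂ => g s) this

theorem exists_extendEval_eq_div (s : S) : ∃ (a : A) (n : ℕ),
    ∀ y : Point A, y.eval f ≠ 0 → extendEval S f x hx y s = y.eval a / y.eval f ^ n := by
  obtain ⟨n, a, h⟩ := IsLocalization.Away.surj f s
  refine ⟨a, n, fun y hy => ?_⟩
  rw [eq_div_iff (pow_ne_zero n hy), ← extendEval_algebraMap (S := S) hx hy a, ← h, map_mul,
    map_pow, extendEval_algebraMap hx hy]

theorem eventually_eval_ne_zero {B : Type*} [CommRing B] [Algebra ℂ B] {g : B} {x : Point B}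
    (hx : x.eval g ≠ 0) : ∀ᶠ y in 𝓝 x, y.eval g ≠ 0 :=
  (continuous_eval g).continuousAt.eventually_ne hx

theorem continuousAt_extendEval (s : S) :
    ContinuousAt (fun y => extendEval S f x hx y s) x := by
  obtain ⟨a, n, h⟩ := exists_extendEval_eq_div hx s
  have h1 : ContinuousAt (fun y : Point A => y.eval a / y.eval f ^ n) x :=
    (continuous_eval a).continuousAt.div ((continuous_eval f).continuousAt.pow n)
      (pow_ne_zero n hx)
  refine h1.congr ?_
  filter_upwards [eventually_eval_ne_zero hx] with y hy
  exact (h y hy).symm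

theorem coe_localizedGerm (s : S) : (localizedGerm S f x hx s : Germ (𝓝 x) ℂ) =
    ((fun y => extendEval S f x hx y s : Point A → ℂ) : Germ (𝓝 x) ℂ) := by
  obtain ⟨n, a, h⟩ := IsLocalization.Away.surj f s
  have hu : IsUnit ((regularGerm x f : Germ (𝓝 x) ℂ) ^ n) :=
    ((isUnit_regularGerm hx).map (AnalyticGerm x).val).pow n
  refine hu.mul_right_cancel ?_
  have h1 := congrArg (localizedGerm S f x hx) h
  rw [map_mul, map_pow, localizedGerm_algebraMap, localizedGerm_algebraMap] at h1
  refine (congrArg Subtype.val h1).trans (Germ.coe_eq.mpr ?_)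
  filter_upwards [eventually_eval_ne_zero hx] with y hy
  have h2 := congrArg (extendEval S f x hx y) h
  rw [map_mul, map_pow, extendEval_algebraMap hx hy, extendEval_algebraMap hx hy] at h2
  exact h2.symm

/-- Elements of S are quotients a/fⁿ. Taking f as an additional coordinate, indexed by `none`, makes
the division part of the analytic function. -/
theorem mem_analyticGerm_extendEval {κ : Type*} [Fintype κ] (t : κ → S) {F : (κ → ℂ) → ℂ}
    (hF : AnalyticAt ℂ F fun i => extendEval S f x hx x (t i)) :
    ((fun y : Point A => F fun i => extendEval S f x hx y (t i) : Point A → ℂ) : Germ (𝓝 x) ℂ) ∈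
      AnalyticGerm x := by
  choose a n h using fun i => exists_extendEval_eq_div hx (t i)
  let b : Option κ → A := fun o => o.elim f a
  let G : (Option κ → ℂ) → ℂ := fun z => F fun i => z (some i) / z none ^ n i
  have hG : AnalyticAt ℂ G fun o => x.eval (b o) := by
    refine AnalyticAt.fun_comp (g := F)
      (f := fun (z : Option κ → ℂ) i => z (some i) / z none ^ n i) ?_ ?_
    · convert hF using 2 with i
      exact (h i x hx).symm
    · refine AnalyticAt.pi fun i => AnalyticAt.div ?_ (AnalyticAt.pow ?_ _) (pow_ne_zero _ hx)
      · exact (ContinuousLinearMap.proj (R := ℂ) (φ := fun _ : Option κ => ℂ) (some i)).analyticAt _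
      · exact (ContinuousLinearMap.proj (R := ℂ) (φ := fun _ : Option κ => ℂ) none).analyticAt _
  have := mem_analyticGerm b hG
  convert this using 1
  refine Germ.coe_eq.mpr ?_
  filter_upwards [eventually_eval_ne_zero hx] with y hy
  simp only [G, b, h _ y hy, Option.elim]

/-- Pullback of germs along a map. -/
def germPullback {P Q : Type*} {l : Filter P} {m : Filter Q} (T : P → Q) (hT : Tendsto T l m) :
    Germ m ℂ →ₐ[ℂ] Germ l ℂ where
  toFun g := g.compTendsto T hT
  map_one' := rfl
  map_mul' g h := by
    induction g using Germ.inductionOn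
    induction h using Germ.inductionOn
    rfl
  map_zero' := rfl
  map_add' g h := by
    induction g using Germ.inductionOn
    induction h using Germ.inductionOn
    rfl
  commutes' c := by
    rw [Algebra.algebraMap_eq_smul_one (A := Germ l ℂ), Algebra.algebraMap_eq_smul_one]
    rfl

theorem germPullback_coe {P Q : Type*} {l : Filter P} {m : Filter Q} (T : P → Q)
    (hT : Tendsto T l m) (F : Q → ℂ) :
    germPullback T hT (F : Germ m ℂ) = ((fun y => F (T y) : P → ℂ) : Germ l ℂ) := rfl

/-- The hypothesis `hm` says that T sends neighbourhoods to neighbourhoods, so an identity checked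
on the source holds near the target point. -/
theorem germPullback_injective {P Q : Type*} {l : Filter P} {m : Filter Q} (T : P → Q)
    (hT : Tendsto T l m) (hm : m ≤ Filter.map T l) : Function.Injective (germPullback T hT) := by
  intro g h hgh
  induction g using Germ.inductionOn with | _ F =>
  induction h using Germ.inductionOn with | _ G =>
  rw [germPullback_coe, germPullback_coe, Germ.coe_eq] at hgh
  exact Germ.coe_eq.mpr (hm hgh)

variable {ι σ : Type} [Fintype ι] [Fintype σ]

/-- A submersive presentation provides analytic coordinates. -/
theorem exists_localRing_equiv (P : Algebra.SubmersivePresentation ℂ S ι σ)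
    [Fintype ((Set.range P.map)ᶜ : Set ι)] :
    ∃ e : LocalRing ((Set.range P.map)ᶜ : Set ι) ≃ₐ[ℂ] AnalyticGerm x, ∀ k,
      e (LocalRing.coord k) = localizedGerm S f x hx (P.val k) -
        algebraMap ℂ _ (extendEval S f x hx x (P.val k)) := by
  classical
  obtain ⟨ψ, hψ, hψ0, hψ1, hψ2⟩ := exists_implicit_parametrization P (extendEval S f x hx x)
  let Z : Point A → ι → ℂ := fun y i => extendEval S f x hx y (P.val i)
  let T : Point A → (((Set.range P.map)ᶜ : Set ι) → ℂ) := fun y k => Z y k - Z x k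
  have heval : ∀ (φ : S →ₐ[ℂ] ℂ) (q : MvPolynomial ι ℂ),
      MvPolynomial.eval (fun i => φ (P.val i)) q = φ (MvPolynomial.aeval P.val q) := by
    intro φ q
    rw [← AlgHom.comp_apply, MvPolynomial.comp_aeval, MvPolynomial.aeval_eq_eval]
  have hZ : ContinuousAt Z x := continuousAt_pi.mpr fun i => continuousAt_extendEval hx (P.val i)
  have hT0 : T x = 0 := funext fun k => sub_self _
  have hT : Tendsto T (𝓝 x) (𝓝 0) := by
    rw [← hT0]
    exact tendsto_pi_nhds.mpr fun k =>
      (continuousAt_extendEval hx (P.val k)).sub continuousAt_const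
  have hZψ : ∀ᶠ y in 𝓝 x, Z y = ψ (T y) := by
    filter_upwards [hZ.eventually hψ2] with y hy
    refine hy fun r => ?_
    rw [heval, P.aeval_val_relation, map_zero]
  -- the local inverse of `T`
  have hpt : ∀ᶠ w in 𝓝 (0 : ((Set.range P.map)ᶜ : Set ι) → ℂ), ∃ φ : S →ₐ[ℂ] ℂ,
      ∀ i, φ (P.val i) = ψ w i := by
    filter_upwards [hψ1] with w hw
    -- The relations generate the kernel of the presentation and vanish at ψ(w), so evaluation at
    -- ψ(w) factors through S and defines a point.
    have hker : ∀ q ∈ P.ker, MvPolynomial.aeval (ψ w) q = 0 := by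
      intro q hq
      have h1 : P.ker ≤ RingHom.ker (MvPolynomial.aeval (R := ℂ) (ψ w)) := by
        rw [← P.span_range_relation_eq_ker, Ideal.span_le]
        rintro _ ⟨r, rfl⟩
        have := hw.2 r
        rwa [← MvPolynomial.aeval_eq_eval] at this
      exact h1 hq
    have hsurj : Function.Surjective (MvPolynomial.aeval (R := ℂ) P.val) := P.aeval_val_surjective
    let θ := Ideal.Quotient.liftₐ (RingHom.ker (MvPolynomial.aeval (R := ℂ) P.val))
      (MvPolynomial.aeval (R := ℂ) (ψ w)) fun q hq => hker q (by rwa [P.ker_eq_ker_aeval_val])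
    refine ⟨θ.comp (Ideal.quotientKerAlgEquivOfSurjective hsurj).symm.toAlgHom, fun i => ?_⟩
    have h1 : (Ideal.quotientKerAlgEquivOfSurjective hsurj).symm (P.val i) =
        Ideal.Quotient.mk _ (MvPolynomial.X i) := by
      rw [AlgEquiv.symm_apply_eq]
      exact (MvPolynomial.aeval_X P.val i).symm
    change θ ((Ideal.quotientKerAlgEquivOfSurjective hsurj).symm (P.val i)) = _
    rw [h1]
    exact MvPolynomial.aeval_X (ψ w) i
  obtain ⟨φ, hφ⟩ : ∃ φ : (((Set.range P.map)ᶜ : Set ι) → ℂ) → S →ₐ[ℂ] ℂ,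
      ∀ᶠ w in 𝓝 0, ∀ i, φ w (P.val i) = ψ w i := by
    have : ∀ w, ∃ φ : S →ₐ[ℂ] ℂ, (∃ φ : S →ₐ[ℂ] ℂ, ∀ i, φ (P.val i) = ψ w i) →
        ∀ i, φ (P.val i) = ψ w i := by
      intro w
      by_cases h : ∃ φ : S →ₐ[ℂ] ℂ, ∀ i, φ (P.val i) = ψ w i
      · exact ⟨h.choose, fun _ => h.choose_spec⟩
      · exact ⟨extendEval S f x hx x, fun h' => absurd h' h⟩
    choose φ hφ using this
    exact ⟨φ, hpt.mono fun w hw => hφ w hw⟩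
  let s : (((Set.range P.map)ᶜ : Set ι) → ℂ) → Point A := fun w =>
    ⟨(φ w).comp (IsScalarTower.toAlgHom ℂ A S)⟩
  have hse : ∀ w, extendEval S f x hx (s w) = φ w := fun w => extendEval_eq hx fun a => rfl
  have hs : Tendsto s (𝓝 0) (𝓝 x) := by
    refine tendsto_nhds_point fun a => ?_
    obtain ⟨q, hq⟩ := P.aeval_val_surjective (algebraMap A S a)
    have h1 : ContinuousAt (fun w => MvPolynomial.eval (ψ w) q) 0 :=
      (MvPolynomial.continuous_eval q).continuousAt.comp hψ.continuousAt
    have h2 : MvPolynomial.eval (ψ 0) q = x.eval a := by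
      rw [hψ0, heval, hq, extendEval_algebraMap hx hx]
    rw [← h2]
    refine h1.tendsto.congr' ?_
    filter_upwards [hφ] with w hw
    have h3 : ψ w = fun i => φ w (P.val i) := funext fun i => (hw i).symm
    rw [h3, heval, hq]
    rfl
  have hTs : ∀ᶠ w in 𝓝 0, T (s w) = w := by
    filter_upwards [hφ, hψ1] with w h1 h2
    funext k
    change extendEval S f x hx (s w) (P.val k) - _ = _
    rw [hse, h1]
    exact h2.1 k
  -- The continuous local section s of T shows that T is open at x, which is what injectivity of the
  -- pullback requires.
  have hmap : 𝓝 0 ≤ Filter.map T (𝓝 x) := by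
    intro u hu
    have h1 : ∀ᶠ w in 𝓝 0, T (s w) ∈ u := hs.eventually hu
    filter_upwards [h1, hTs] with w h2 h3
    rwa [h3] at h2
  have himage : (LocalRing ((Set.range P.map)ᶜ : Set ι)).map (germPullback T hT) =
      AnalyticGerm x := by
    refine le_antisymm ?_ ?_
    · rintro _ ⟨_, ⟨F, hF, rfl⟩, rfl⟩
      have hF' : AnalyticAt ℂ F 0 := hF
      have hsub : AnalyticAt ℂ (fun (v : ((Set.range P.map)ᶜ : Set ι) → ℂ) =>
          v - fun k : ((Set.range P.map)ᶜ : Set ι) => Z x k) (fun k => Z x k) :=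
        analyticAt_id.sub analyticAt_const
      exact mem_analyticGerm_extendEval hx (fun k : ((Set.range P.map)ᶜ : Set ι) => P.val k)
        (F := fun v => F (v - fun k : ((Set.range P.map)ᶜ : Set ι) => Z x k))
        (hF'.comp_of_eq hsub (sub_self _))
    -- Regular functions are polynomials in the generators of S, and near x the generators are ψ ∘
    -- T, so an analytic function of regular functions is an analytic function of T.
    · rintro _ ⟨n, a, G, hG, rfl⟩
      choose q hq using fun j => P.aeval_val_surjective (algebraMap A S (a j))
      have hpoint : ∀ j, MvPolynomial.eval (ψ 0) (q j) = x.eval (a j) := fun j => by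
        rw [hψ0, heval, hq, extendEval_algebraMap hx hx]
      refine ⟨_, ⟨fun w => G fun j => MvPolynomial.eval (ψ w) (q j), ?_, rfl⟩, ?_⟩
      · refine hG.comp_of_eq (AnalyticAt.pi fun j => ?_) (funext hpoint)
        exact (AnalyticOnNhd.eval_mvPolynomial (𝕜 := ℂ) (q j) (ψ 0) (Set.mem_univ _)).comp hψ
      · refine Germ.coe_eq.mpr ?_
        filter_upwards [hZψ, eventually_eval_ne_zero hx] with y h1 h2
        change G (fun j => MvPolynomial.eval (ψ (T y)) (q j)) = G fun j => y.eval (a j)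
        congr 1
        funext j
        rw [← h1, heval, hq, extendEval_algebraMap hx h2]
  refine ⟨((LocalRing ((Set.range P.map)ᶜ : Set ι)).equivMapOfInjective (germPullback T hT)
    (germPullback_injective T hT hmap)).trans (Subalgebra.equivOfEq _ _ himage), fun k => ?_⟩
  refine Subtype.ext ?_
  rw [AddSubgroupClass.coe_sub, coe_localizedGerm, Subalgebra.coe_algebraMap,
    Algebra.algebraMap_eq_smul_one]
  refine Germ.coe_eq.mpr (Eventually.of_forall fun y => ?_)
  simp [T, Z]

end Chart

/-! ### Kähler differentials, dual derivations and algebraic dependence. -/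

section Algebraic

open KaehlerDifferential

variable {S κ : Type*} [CommRing S] [Algebra ℂ S] {t : κ → S}
  (b : Module.Basis κ S Ω[S⁄ℂ])

theorem derivation_eq_zero_of_basis (hb : ∀ k, b k = D ℂ S (t k))
    {N : Type*} [AddCommGroup N] [Module S N] [Module ℂ N]
    [IsScalarTower ℂ S N] (d : Derivation ℂ S N) (hd : ∀ k, d (t k) = 0) : d = 0 := by
  have h : d.liftKaehlerDifferential = 0 := b.ext fun k => by
    rw [hb, Derivation.liftKaehlerDifferential_comp_D, hd, LinearMap.zero_apply]
  ext s
  rw [← d.liftKaehlerDifferential_comp_D, h]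
  rfl

/-- The derivation dual to a basis of differentials. -/
def dualDerivation (k : κ) : Derivation ℂ S S := (b.coord k).compDer (D ℂ S)

theorem dualDerivation_apply (k : κ) (s : S) : dualDerivation b k s = b.repr (D ℂ S s) k := rfl

theorem dualDerivation_coord (hb : ∀ k, b k = D ℂ S (t k))
    [DecidableEq κ] (i j : κ) :
    dualDerivation b i (t j) = if i = j then 1 else 0 := by
  rw [dualDerivation_apply, ← hb, b.repr_self, Finsupp.single_apply, if_congr eq_comm rfl rfl]

variable {K : Type*} [Field K] [Algebra S K] [IsFractionRing S K] [Algebra ℂ K]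
  [IsScalarTower ℂ S K]

variable (K) in
/-- The basis of differentials of the fraction field. -/
def fractionBasis : Module.Basis κ K Ω[K⁄ℂ] :=
  b.ofIsLocalizedModule K (nonZeroDivisors S) (KaehlerDifferential.map ℂ ℂ S K)

theorem fractionBasis_apply (hb : ∀ k, b k = D ℂ S (t k)) (k : κ) :
    fractionBasis b K k = D ℂ K (algebraMap S K (t k)) := by
  rw [fractionBasis, Module.Basis.ofIsLocalizedModule_apply, hb, KaehlerDifferential.map_D]

theorem dualDerivation_fractionBasis_algebraMap (k : κ) (s : S) :
    dualDerivation (fractionBasis b K) k (algebraMap S K s) =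
      algebraMap S K (dualDerivation b k s) := by
  rw [dualDerivation_apply, dualDerivation_apply, fractionBasis,
    ← Module.Basis.ofIsLocalizedModule_repr_apply K (nonZeroDivisors S)
      (KaehlerDifferential.map ℂ ℂ S K) b, KaehlerDifferential.map_D]

/-- If the coordinates are algebraically independent at a point, the elements of `S` are algebraic
over the polynomials in them. -/
theorem exists_dvd_aeval [IsDomain S] (hb : ∀ k, b k = D ℂ S (t k))
    [Algebra.EssFiniteType ℂ K] (ht : AlgebraicIndependent ℂ t) {s : S}
    (hs : s ≠ 0) : ∃ q : MvPolynomial κ ℂ, q ≠ 0 ∧ s ∣ MvPolynomial.aeval t q := by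
  let : Algebra (MvPolynomial κ ℂ) S := (MvPolynomial.aeval t).toAlgebra
  let : Algebra (MvPolynomial κ ℂ) K :=
    ((algebraMap S K).comp (MvPolynomial.aeval t).toRingHom).toAlgebra
  have : IsScalarTower (MvPolynomial κ ℂ) S K := IsScalarTower.of_algebraMap_eq fun _ => rfl
  have : IsScalarTower ℂ (MvPolynomial κ ℂ) K := IsScalarTower.of_algebraMap_eq fun c => by
    change _ = algebraMap S K (MvPolynomial.aeval t (MvPolynomial.C c))
    rw [MvPolynomial.aeval_C, ← IsScalarTower.algebraMap_apply]
  have hinj : Function.Injective (algebraMap (MvPolynomial κ ℂ) K) :=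
    (IsFractionRing.injective S K).comp ht
  have : FaithfulSMul (MvPolynomial κ ℂ) K := (faithfulSMul_iff_algebraMap_injective _ _).mpr hinj
  let : Algebra (FractionRing (MvPolynomial κ ℂ)) K :=
    FractionRing.liftAlgebra (MvPolynomial κ ℂ) K
  have : IsScalarTower (MvPolynomial κ ℂ) (FractionRing (MvPolynomial κ ℂ)) K :=
    FractionRing.isScalarTower_liftAlgebra _ _
  have : IsScalarTower ℂ (FractionRing (MvPolynomial κ ℂ)) K :=
    IsScalarTower.to₁₃₄ ℂ (MvPolynomial κ ℂ) (FractionRing (MvPolynomial κ ℂ)) K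
  have : Algebra.EssFiniteType (FractionRing (MvPolynomial κ ℂ)) K :=
    Algebra.EssFiniteType.of_comp ℂ (FractionRing (MvPolynomial κ ℂ)) K
  -- The differentials of the coordinates generate Ω over ℂ and become zero over the field ℂ(t).
  -- Hence K has no differentials over ℂ(t), is unramified over it, and so is algebraic.
  have hD : (D (FractionRing (MvPolynomial κ ℂ)) K).restrictScalars ℂ = 0 := by
    refine derivation_eq_zero_of_basis (fractionBasis b K) (fractionBasis_apply b hb) _ fun k => ?_
    have : algebraMap S K (t k) = algebraMap (FractionRing (MvPolynomial κ ℂ)) K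
        (algebraMap (MvPolynomial κ ℂ) (FractionRing (MvPolynomial κ ℂ)) (MvPolynomial.X k)) := by
      rw [← IsScalarTower.algebraMap_apply]
      change _ = algebraMap S K (MvPolynomial.aeval t (MvPolynomial.X k))
      rw [MvPolynomial.aeval_X]
    rw [this]
    exact (D (FractionRing (MvPolynomial κ ℂ)) K).map_algebraMap _
  have : Algebra.FormallyUnramified (FractionRing (MvPolynomial κ ℂ)) K := by
    refine ⟨subsingleton_of_forall_eq 0 fun ω => ?_⟩
    have hω : ω ∈ Submodule.span K (Set.range (D (FractionRing (MvPolynomial κ ℂ)) K)) := by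
      rw [span_range_derivation]
      exact Submodule.mem_top
    refine (Submodule.mem_bot K).mp (Submodule.span_le.mpr ?_ hω)
    rintro _ ⟨y, rfl⟩
    exact congrArg (fun d : Derivation ℂ K _ => d y) hD
  have := Algebra.FormallyUnramified.isSeparable (FractionRing (MvPolynomial κ ℂ)) K
  have halg : IsAlgebraic (FractionRing (MvPolynomial κ ℂ)) (algebraMap S K s) :=
    Algebra.IsAlgebraic.isAlgebraic _
  have halg' : IsAlgebraic (MvPolynomial κ ℂ) s := by
    rw [← isAlgebraic_algebraMap_iff (IsFractionRing.injective S K)]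
    exact (IsFractionRing.isAlgebraic_iff _ _ _).mpr halg
  -- A nonzero algebraic element of a domain satisfies an equation with nonzero constant term, and
  -- it divides that term.
  exact halg'.exists_nonzero_dvd (mem_nonZeroDivisors_of_ne_zero hs)

end Algebraic

/-! ### Construction of charts on the smooth variety. -/

section Charts

variable {A K : Type*} [CommRing A] [Algebra ℂ A] [Field K]

/-- Rational functions `u` and rational vector fields `X` on a variety which are, up to constants,
a system of analytic coordinates at a point and the corresponding partial derivatives. -/
structure Chart [Algebra A K] [Algebra ℂ K] {κ : Type*} [Fintype κ] [DecidableEq κ]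
    (u : κ → K) (X : κ → Derivation ℂ K K) (x : Point A) where
  toCoordinates : AnalyticCoordinates (AnalyticGerm x) κ
  center : κ → ℂ
  isFunctionGerm : ∀ i, IsFunctionGerm x (u i - algebraMap ℂ K (center i)) (toCoordinates.coord i)
  isFieldGerm : ∀ i, IsFieldGerm x (X i) (toCoordinates.pderiv i)
  apply_coord : ∀ i j, X i (u j) = if i = j then 1 else 0
  derivation_eq_zero : ∀ Y : Derivation ℂ K K, (∀ i, Y (u i) = 0) → Y = 0
  regularGerm_injective : ∀ a : A, regularGerm x a = 0 → a = 0

variable {S : Type*} [CommRing S] [Algebra ℂ S] [Algebra A S] [IsScalarTower ℂ A S]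
  {f : A} [IsLocalization.Away f S] {x : Point A} (hx : x.eval f ≠ 0)
  [Algebra S K]

theorem isFunctionGerm_localizedGerm [Algebra A K] [IsScalarTower A S K] [Nontrivial A]
    (hf : algebraMap A K f ≠ 0) (s : S) :
    IsFunctionGerm x (algebraMap S K s) (localizedGerm S f x hx s) := by
  obtain ⟨n, a, h⟩ := IsLocalization.Away.surj f s
  refine IsFunctionGerm.of_mul_regular (c := f ^ n) (by simpa using fun h => absurd h hf) ?_
  have h1 : algebraMap S K s * algebraMap A K (f ^ n) = algebraMap A K a := by
    rw [IsScalarTower.algebraMap_apply A S K, IsScalarTower.algebraMap_apply A S K a, ← h,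
      map_mul, map_pow, map_pow]
  have h2 : localizedGerm S f x hx s * regularGerm x (f ^ n) = regularGerm x a := by
    rw [← localizedGerm_algebraMap (S := S) hx, ← localizedGerm_algebraMap (S := S) hx a, ← h,
      map_mul, map_pow, map_pow]
  rw [h1, h2]
  exact IsFunctionGerm.regular a

open KaehlerDifferential in
-- The two sides are derivations from S to the germs agreeing on elements whose differentials form a
-- basis.
theorem localizedGerm_dualDerivation {κ : Type*} [Fintype κ] [DecidableEq κ] {t : κ → S}
    (b : Module.Basis κ S Ω[S⁄ℂ]) (hb : ∀ k, b k = D ℂ S (t k))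
    (C : AnalyticCoordinates (AnalyticGerm x) κ)
    (hC : ∀ k, localizedGerm S f x hx (t k) = C.coord k) (k : κ) (s : S) :
    C.pderiv k (localizedGerm S f x hx s) = localizedGerm S f x hx (dualDerivation b k s) := by
  let : Algebra S (AnalyticGerm x) := (localizedGerm S f x hx).toAlgebra
  have : IsScalarTower ℂ S (AnalyticGerm x) :=
    IsScalarTower.of_algebraMap_eq fun c => ((localizedGerm S f x hx).commutes c).symm
  have h := derivation_eq_zero_of_basis b hb
    ((C.pderiv k).compAlgebraMap S - (Algebra.linearMap S (AnalyticGerm x)).compDer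
      (dualDerivation b k)) fun j => by
    change C.pderiv k (localizedGerm S f x hx (t j)) -
      localizedGerm S f x hx (dualDerivation b k (t j)) = 0
    rw [hC, C.pderiv_coord, dualDerivation_coord b hb]
    split_ifs <;> simp
  exact sub_eq_zero.mp (congrArg (fun d : Derivation ℂ S (AnalyticGerm x) => d s) h)

open KaehlerDifferential in
-- A nonzero s divides some nonzero polynomial q(t). If its germ were zero, so would be q of the
-- coordinate germs, contradicting their algebraic independence.
theorem localizedGerm_injective {κ : Type*} [Fintype κ] [DecidableEq κ] {t : κ → S}
    [IsDomain S] [IsFractionRing S K] [Algebra ℂ K] [IsScalarTower ℂ S K]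
    [Algebra.EssFiniteType ℂ K] (b : Module.Basis κ S Ω[S⁄ℂ]) (hb : ∀ k, b k = D ℂ S (t k))
    (C : AnalyticCoordinates (AnalyticGerm x) κ)
    (hC : ∀ k, localizedGerm S f x hx (t k) = C.coord k) {s : S}
    (hs : localizedGerm S f x hx s = 0) : s = 0 := by
  by_contra hne
  have haeval : ∀ q : MvPolynomial κ ℂ,
      localizedGerm S f x hx (MvPolynomial.aeval t q) = MvPolynomial.aeval C.coord q := by
    intro q
    rw [← AlgHom.comp_apply, MvPolynomial.comp_aeval]
    exact congrArg (fun g => MvPolynomial.aeval g q) (funext hC)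
  have ht : AlgebraicIndependent ℂ t := fun p q h => C.algebraicIndependent <| by
    change MvPolynomial.aeval t p = MvPolynomial.aeval t q at h
    change MvPolynomial.aeval C.coord p = MvPolynomial.aeval C.coord q
    rw [← haeval, ← haeval, h]
  obtain ⟨q, hq, r, hr⟩ := exists_dvd_aeval (K := K) b hb ht hne
  refine hq (C.algebraicIndependent ?_)
  change MvPolynomial.aeval C.coord q = MvPolynomial.aeval C.coord 0
  rw [map_zero, ← haeval, hr, map_mul, hs, zero_mul]

/-- A submersive presentation of a principal localization gives charts at all points of the
corresponding open set. -/
theorem nonempty_chart (hx : x.eval f ≠ 0) [Algebra A K] [IsScalarTower A S K] [Algebra ℂ K]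
    [IsDomain A] [IsDomain S] [IsFractionRing S K] [IsScalarTower ℂ S K]
    [Algebra.EssFiniteType ℂ K] (hf : algebraMap A K f ≠ 0)
    (hS : Function.Injective (algebraMap A S))
    {ι σ : Type} [Fintype ι] [Fintype σ] (P : Algebra.SubmersivePresentation ℂ S ι σ)
    [Fintype ((Set.range P.map)ᶜ : Set ι)] [DecidableEq ((Set.range P.map)ᶜ : Set ι)] :
    Nonempty (Chart (fun k : ((Set.range P.map)ᶜ : Set ι) => algebraMap S K (P.val k))
      (fun k => dualDerivation (fractionBasis P.basisKaehler K) k) x) := by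
  obtain ⟨e, he⟩ := exists_localRing_equiv hx P
  let C := (LocalRing.coordinates ((Set.range P.map)ᶜ : Set ι)).map e
  let c : ((Set.range P.map)ᶜ : Set ι) → ℂ := fun k => extendEval S f x hx x (P.val k)
  let t : ((Set.range P.map)ᶜ : Set ι) → S := fun k => P.val k - algebraMap ℂ S (c k)
  have hb : ∀ k, P.basisKaehler k = KaehlerDifferential.D ℂ S (t k) := fun k => by
    rw [P.basisKaehler_apply, map_sub, Derivation.map_algebraMap, sub_zero]
  have hb' : ∀ k, P.basisKaehler k = KaehlerDifferential.D ℂ S (P.val k) := P.basisKaehler_apply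
  have hC : ∀ k, localizedGerm S f x hx (t k) = C.coord k := fun k => by
    rw [map_sub, AlgHom.commutes]
    exact (he k).symm
  refine ⟨⟨C, c, fun k => ?_, fun k a => ?_, fun i j => ?_, fun Y hY => ?_, fun a ha => ?_⟩⟩
  · rw [← hC, IsScalarTower.algebraMap_apply ℂ S K, ← map_sub]
    exact isFunctionGerm_localizedGerm hx hf (t k)
  · rw [IsScalarTower.algebraMap_apply A S K, dualDerivation_fractionBasis_algebraMap,
      ← localizedGerm_algebraMap (S := S) hx, localizedGerm_dualDerivation hx _ hb C hC]
    exact isFunctionGerm_localizedGerm hx hf _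
  · exact dualDerivation_coord (fractionBasis P.basisKaehler K)
      (fractionBasis_apply P.basisKaehler hb') i j
  · exact derivation_eq_zero_of_basis (fractionBasis P.basisKaehler K)
      (fractionBasis_apply P.basisKaehler hb') Y hY
  · refine hS ?_
    rw [map_zero]
    refine localizedGerm_injective (K := K) hx _ hb C hC ?_
    rw [localizedGerm_algebraMap, ha]

/-- A smooth algebra is standard smooth on a principal neighbourhood of each point. The same `u` and
`X` serve at all points of that neighbourhood, which leaves room to move afterwards to a point where
a given connection is regular. -/
theorem exists_chart [Algebra A K] [Algebra ℂ K] [IsDomain A] [IsFractionRing A K]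
    [IsScalarTower ℂ A K] [Algebra.Smooth ℂ A] (x₀ : Point A) :
    ∃ f : A, x₀.eval f ≠ 0 ∧ ∃ (κ : Type) (_ : Fintype κ) (_ : DecidableEq κ) (u : κ → K)
      (X : κ → Derivation ℂ K K), ∀ x : Point A, x.eval f ≠ 0 → Nonempty (Chart u X x) := by
  classical
  have hp : (RingHom.ker x₀.eval).IsPrime := RingHom.ker_isPrime _
  obtain ⟨f, hf, hstd⟩ := Algebra.IsSmoothAt.exists_notMem_isStandardSmooth (R := ℂ)
    (RingHom.ker x₀.eval)
  rw [RingHom.mem_ker] at hf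
  refine ⟨f, hf, ?_⟩
  obtain ⟨ι, σ, _, _, ⟨P⟩⟩ := hstd.out
  have := Fintype.ofFinite ι
  have := Fintype.ofFinite σ
  have hf0 : f ≠ 0 := by
    rintro rfl
    exact hf (map_zero _)
  have hfK : algebraMap A K f ≠ 0 := by
    rwa [Ne, FaithfulSMul.algebraMap_eq_zero_iff]
  have hle : Submonoid.powers f ≤ nonZeroDivisors A :=
    powers_le_nonZeroDivisors_of_noZeroDivisors hf0
  have : IsDomain (Localization.Away f) := IsLocalization.isDomain_localization hle
  let : Algebra (Localization.Away f) K := (IsLocalization.lift (M := Submonoid.powers f)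
    (g := algebraMap A K) fun m => by
      obtain ⟨n, hn⟩ := m.2
      rw [← hn, map_pow]
      exact (pow_ne_zero n hfK).isUnit).toAlgebra
  have : IsScalarTower A (Localization.Away f) K := IsScalarTower.of_algebraMap_eq fun a =>
    (IsLocalization.lift_eq _ _).symm
  have : IsScalarTower ℂ (Localization.Away f) K := IsScalarTower.of_algebraMap_eq fun c => by
    rw [IsScalarTower.algebraMap_apply ℂ A (Localization.Away f),
      ← IsScalarTower.algebraMap_apply A, ← IsScalarTower.algebraMap_apply]
  have : IsFractionRing (Localization.Away f) K :=
    IsFractionRing.isFractionRing_of_isDomain_of_isLocalization (Submonoid.powers f) _ _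
  have : Algebra.EssFiniteType A K := .of_isLocalization K (nonZeroDivisors A)
  have : Algebra.EssFiniteType ℂ K := .comp ℂ A K
  exact ⟨_, inferInstance, inferInstance, _, _, fun x hx => nonempty_chart hx hfK
    (IsLocalization.injective _ hle) P⟩

end Charts

/-! ### Transfer between the function field and analytic germs. -/

section Comparison

variable {A K : Type*} [CommRing A] [Algebra ℂ A]

/-- A nonzero regular function on an affine variety does not vanish at some complex point. -/
theorem exists_point_eval_ne_zero [IsDomain A] [Algebra.FiniteType ℂ A] {h : A} (hh : h ≠ 0) :
    ∃ x : Point A, x.eval h ≠ 0 := by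
  have : IsDomain (Localization.Away h) :=
    IsLocalization.isDomain_localization (powers_le_nonZeroDivisors_of_noZeroDivisors hh)
  have : Algebra.FiniteType A (Localization.Away h) :=
    IsLocalization.finiteType_of_monoid_fg (.powers h) _
  have : Algebra.FiniteType ℂ (Localization.Away h) := .trans (S := A) inferInstance inferInstance
  obtain ⟨m, hm⟩ := Ideal.exists_maximal (Localization.Away h)
  let := Ideal.Quotient.field m
  have := finite_of_finite_type_of_isJacobsonRing ℂ (Localization.Away h ⧸ m)
  let φ : (Localization.Away h ⧸ m) →ₐ[ℂ] ℂ := IsAlgClosed.lift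
  refine ⟨⟨(φ.comp (Ideal.Quotient.mkₐ ℂ m)).comp (IsScalarTower.toAlgHom ℂ A _)⟩, ?_⟩
  exact ((IsLocalization.Away.algebraMap_isUnit (S := Localization.Away h) h).map
    (φ.comp (Ideal.Quotient.mkₐ ℂ m))).ne_zero

variable [Field K] [Algebra A K] [Algebra ℂ K]

namespace Chart

variable {κ : Type*} [Fintype κ] [DecidableEq κ] {u : κ → K} {X : κ → Derivation ℂ K K}
  {x : Point A}

theorem eq_zero_of_isFunctionGerm_zero (c : Chart u X x) {f : K} (h : IsFunctionGerm x f 0) :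
    f = 0 := by
  obtain ⟨b, e, he, h1, h2⟩ := h
  rw [zero_mul] at h2
  rw [c.regularGerm_injective b h2.symm, map_zero] at h1
  exact (mul_eq_zero.mp h1).resolve_right he

/-- `IsFunctionGerm` only gives g·c = 0 with c ≠ 0. The germ of c is nonzero by injectivity, and the
germs form a domain. -/
theorem germ_eq_zero_of_isFunctionGerm (c : Chart u X x) [FaithfulSMul A K] {g : AnalyticGerm x}
    (h : IsFunctionGerm x (0 : K) g) : g = 0 := by
  have := c.toCoordinates.isDomain
  obtain ⟨b, e, he, h1, h2⟩ := h
  rw [zero_mul, eq_comm, FaithfulSMul.algebraMap_eq_zero_iff] at h1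
  rw [h1, ← regularGermHom_apply x 0, map_zero] at h2
  refine (mul_eq_zero.mp h2).resolve_right fun h => he ?_
  rw [c.regularGerm_injective e h, map_zero]

variable {Y : Derivation ℂ K K} {V : Derivation ℂ (AnalyticGerm x) (AnalyticGerm x)}

theorem apply_sub_center (c : Chart u X x) (Y : Derivation ℂ K K) (i : κ) :
    Y (u i - algebraMap ℂ K (c.center i)) = Y (u i) := by
  rw [map_sub, Y.map_algebraMap, sub_zero]

theorem isFunctionGerm_apply_coord (c : Chart u X x) (h : IsFieldGerm x Y V) (i : κ) :
    IsFunctionGerm x (Y (u i)) (V (c.toCoordinates.coord i)) := by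
  rw [← c.apply_sub_center Y i]
  exact (c.isFunctionGerm i).derivation h

theorem eq_zero_of_isFieldGerm_zero (c : Chart u X x) (h : IsFieldGerm x Y 0) : Y = 0 :=
  c.derivation_eq_zero Y fun i =>
    c.eq_zero_of_isFunctionGerm_zero (c.isFunctionGerm_apply_coord h i)

theorem germ_eq_zero_of_isFieldGerm (c : Chart u X x) [FaithfulSMul A K]
    (h : IsFieldGerm x (0 : Derivation ℂ K K) V) : V = 0 :=
  c.toCoordinates.derivation_eq_zero V fun i =>
    c.germ_eq_zero_of_isFunctionGerm (c.isFunctionGerm_apply_coord h i)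

theorem derivation_eq_sum (c : Chart u X x) (Y : Derivation ℂ K K) : Y = ∑ i, Y (u i) • X i := by
  refine sub_eq_zero.mp (c.derivation_eq_zero _ fun j => ?_)
  rw [Derivation.sub_apply, sub_eq_zero, ← Derivation.coeFnAddMonoidHom_apply (∑ i, _), map_sum,
    Finset.sum_apply]
  simp [c.apply_coord]

theorem span_range (c : Chart u X x) : Submodule.span K (Set.range X) = ⊤ := by
  refine eq_top_iff.mpr fun Y _ => ?_
  rw [c.derivation_eq_sum Y]
  exact Submodule.sum_mem _ fun i _ =>
    Submodule.smul_mem _ _ (Submodule.subset_span (Set.mem_range_self i))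

theorem isFieldGerm_of_apply_coord [Nontrivial A] (c : Chart u X x)
    (h : ∀ i, IsFunctionGerm x (Y (u i)) (V (c.toCoordinates.coord i))) : IsFieldGerm x Y V := by
  rw [c.derivation_eq_sum Y, c.toCoordinates.derivation_eq_sum V]
  exact IsFieldGerm.sum _ fun i _ => IsFieldGerm.smul (h i) (c.isFieldGerm i)

theorem cov_apply_coord (c : Chart u X x) (D : Connection ℂ K) (Y Z : Derivation ℂ K K) (a : κ) :
    D.cov Y Z (u a) = Y (Z (u a)) + ∑ i, ∑ b, Y (u i) * (Z (u b) * D.cov (X i) (X b) (u a)) := by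
  have h1 : ∀ b, D.cov Y (X b) (u a) = ∑ i, Y (u i) * D.cov (X i) (X b) (u a) := fun b => by
    conv_lhs => rw [c.derivation_eq_sum Y]
    rw [map_sum, LinearMap.sum_apply, ← Derivation.coeFnAddMonoidHom_apply, map_sum,
      Finset.sum_apply]
    refine Finset.sum_congr rfl fun i _ => ?_
    rw [map_smul]
    rfl
  conv_lhs => rw [c.derivation_eq_sum Z]
  rw [map_sum, ← Derivation.coeFnAddMonoidHom_apply, map_sum, Finset.sum_apply]
  simp only [Derivation.coeFnAddMonoidHom_apply, D.leibniz, Derivation.add_apply,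
    Derivation.smul_apply, c.apply_coord, smul_eq_mul, mul_ite, mul_one, mul_zero,
    Finset.sum_add_distrib, h1, Finset.mul_sum]
  rw [Finset.sum_ite_eq' Finset.univ a, if_pos (Finset.mem_univ a), Finset.sum_comm]
  congr 1
  exact Finset.sum_congr rfl fun i _ => Finset.sum_congr rfl fun b _ => mul_left_comm _ _ _

/-- A connection whose Christoffel symbols are regular at a point has a germ there. -/
theorem isConnectionGerm_connection [Nontrivial A] (c : Chart u X x) {D : Connection ℂ K}
    {Γ : κ → Matrix κ κ (AnalyticGerm x)}
    (hΓ : ∀ i a b, IsFunctionGerm x (D.cov (X i) (X b) (u a)) (Γ i a b)) :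
    IsConnectionGerm x D (c.toCoordinates.connection Γ) := by
  intro Y Z V W hY hZ
  refine c.isFieldGerm_of_apply_coord fun a => ?_
  rw [c.cov_apply_coord, c.toCoordinates.connection_coord]
  refine ((c.isFunctionGerm_apply_coord hZ a).derivation hY).add
    (IsFunctionGerm.sum _ fun i _ => IsFunctionGerm.sum _ fun b _ => ?_)
  exact (c.isFunctionGerm_apply_coord hY i).mul ((c.isFunctionGerm_apply_coord hZ b).mul (hΓ i a b))

variable {D : Connection ℂ K} {E : Connection ℂ (AnalyticGerm x)}

theorem hasParallelTorsion_germ (c : Chart u X x) [FaithfulSMul A K] (hE : IsConnectionGerm x D E)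
    (hD : D.HasParallelTorsion) : E.HasParallelTorsion := by
  refine Connection.hasParallelTorsion_of_span c.toCoordinates.span_pderiv ?_
  rintro _ ⟨i, rfl⟩ _ ⟨j, rfl⟩ _ ⟨l, rfl⟩
  refine c.germ_eq_zero_of_isFieldGerm (K := K) ?_
  have := hE.covTorsion (c.isFieldGerm i) (c.isFieldGerm j) (c.isFieldGerm l)
  rwa [hD] at this

/-- A single regular point suffices, since the chart fields span the rational fields over K and a
rational field with zero germ is zero. -/
theorem hasParallelTorsion_of_germ (c : Chart u X x) (hE : IsConnectionGerm x D E)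
    (h : E.HasParallelTorsion) : D.HasParallelTorsion := by
  refine Connection.hasParallelTorsion_of_span c.span_range ?_
  rintro _ ⟨i, rfl⟩ _ ⟨j, rfl⟩ _ ⟨l, rfl⟩
  refine c.eq_zero_of_isFieldGerm_zero ?_
  have := hE.covTorsion (c.isFieldGerm i) (c.isFieldGerm j) (c.isFieldGerm l)
  rwa [h] at this

theorem span_isHorizontal_germ (c : Chart u X x) [FaithfulSMul A K] (hE : IsConnectionGerm x D E)
    (hD : D.IsFlat) : Submodule.span (AnalyticGerm x) {Y | E.IsHorizontal Y} = ⊤ := by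
  refine c.toCoordinates.span_isHorizontal fun i j b => ?_
  refine c.germ_eq_zero_of_isFieldGerm (K := K) ?_
  have := hE.curvature (c.isFieldGerm i) (c.isFieldGerm j) (c.isFieldGerm b)
  rwa [hD] at this

end Chart

variable [IsDomain A] [IsFractionRing A K] [IsScalarTower ℂ A K] [Algebra.Smooth ℂ A]

/-- A rational connection is regular at some point. -/
theorem exists_chart_isConnectionGerm (D : Connection ℂ K) :
    ∃ (x : Point A) (E : Connection ℂ (AnalyticGerm x)), IsConnectionGerm x D E ∧
      ∃ (κ : Type) (_ : Fintype κ) (_ : DecidableEq κ) (u : κ → K) (X : κ → Derivation ℂ K K),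
        Nonempty (Chart u X x) := by
  obtain ⟨x₀, -⟩ := exists_point_eval_ne_zero (one_ne_zero (α := A))
  obtain ⟨f, hf, κ, _, _, u, X, h⟩ := exists_chart (K := K) x₀
  have hf0 : f ≠ 0 := by
    rintro rfl
    exact hf (map_zero _)
  -- A common denominator of the Christoffel symbols: the connection is regular wherever e and f are
  -- both nonzero, and such a point exists because fe ≠ 0.
  obtain ⟨⟨e, he⟩, hr⟩ := IsLocalization.exist_integer_multiples_of_finite (nonZeroDivisors A)
    fun i : κ × κ × κ => D.cov (X i.1) (X i.2.2) (u i.2.1)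
  have he0 : e ≠ 0 := nonZeroDivisors.ne_zero he
  obtain ⟨x, hx⟩ := exists_point_eval_ne_zero (mul_ne_zero hf0 he0)
  rw [map_mul, mul_ne_zero_iff] at hx
  obtain ⟨c⟩ := h x hx.1
  choose r hr using hr
  obtain ⟨v, hv⟩ := isUnit_regularGerm hx.2
  refine ⟨x, c.toCoordinates.connection fun i => Matrix.of fun a b =>
    regularGerm x (r (i, a, b)) * (v⁻¹ : (AnalyticGerm x)ˣ), c.isConnectionGerm_connection ?_,
    κ, _, _, u, X, ⟨c⟩⟩
  intro i a b
  refine ⟨r (i, a, b), e, by rwa [Ne, FaithfulSMul.algebraMap_eq_zero_iff], ?_, ?_⟩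
  · rw [hr, mul_comm, ← Algebra.smul_def]
  · rw [Matrix.of_apply, mul_assoc, ← hv, Units.inv_mul, mul_one]

/-- A flat rational connection is a Lie connection if and only if its torsion is parallel. -/
theorem isLieConnection_iff (D : Connection ℂ K) :
    IsLieConnection A D ↔ D.IsFlat ∧ D.HasParallelTorsion := by
  refine and_congr_right fun hD => ⟨fun h => ?_, fun h x E hE Y Z hY hZ => ?_⟩
  -- The Lie condition is needed at one regular point only; the converse below treats every regular
  -- point.
  · obtain ⟨x, E, hE, κ, _, _, u, X, ⟨c⟩⟩ := exists_chart_isConnectionGerm (A := A) D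
    exact c.hasParallelTorsion_of_germ hE
      (Connection.hasParallelTorsion_of_lie (c.span_isHorizontal_germ hE hD) (h x E hE))
  · obtain ⟨f, hf, κ, _, _, u, X, hc⟩ := exists_chart (K := K) x
    obtain ⟨c⟩ := hc x hf
    exact (c.hasParallelTorsion_germ hE h).isHorizontal_lie hY hZ

end Comparison

end LieConn

end

/-! ### The four equivalences. -/

theorem proposition3p5 {A K : Type*} [CommRing A] [IsDomain A] [Algebra ℂ A] [Algebra.Smooth ℂ A]
    [Field K] [Algebra A K] [IsFractionRing A K] [Algebra ℂ K] [IsScalarTower ℂ A K]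
    (D : LieConn.Connection ℂ K) :
    List.TFAE [
      LieConn.IsLieConnection A D,
      LieConn.IsLieConnection A D.reciprocal,
      D.IsFlat ∧ D.HasParallelTorsion,
      D.IsFlat ∧ D.reciprocal.IsFlat] := by
  have h34 : (D.IsFlat ∧ D.HasParallelTorsion) ↔ (D.IsFlat ∧ D.reciprocal.IsFlat) :=
    and_congr_right fun h => h.hasParallelTorsion_iff
  have h24 : (D.reciprocal.IsFlat ∧ D.reciprocal.HasParallelTorsion) ↔
      (D.IsFlat ∧ D.reciprocal.IsFlat) := by
    rw [and_comm (a := D.IsFlat)]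
    refine and_congr_right fun h => ?_
    -- The equivalence of parallel torsion and flat reciprocal is applied to ∇^rec, whose reciprocal
    -- is ∇.
    rw [h.hasParallelTorsion_iff, D.reciprocal_reciprocal]
  rw [LieConn.isLieConnection_iff, LieConn.isLieConnection_iff]
  tfae_have 3 ↔ 4 := h34
  tfae_have 2 ↔ 4 := h24
  tfae_have 1 ↔ 3 := Iff.rfl
  tfae_finish
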